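/- Let $m$ be a natural number and $d=\binom{m+1}{2}$. Let $\mathbb S^m\cong\mathbb R^d$ be the space of real symmetric $m\times m$ matrices, with the trace inner product $\langle\theta,\sigma\rangle=\mathrm{tr}(\theta\sigma)$ and Lebesgue measure $d\sigma=\prod_{i\le j}d\sigma_{ij}$. Let $f=\det$ be the determinant of the symmetric $m\times m$ matrix of unknowns, let $C=\mathrm{PD}_m\subset\mathbb S^m$ be the cone of positive definite matrices, and let $K=C^\vee=\{\sigma:\langle\theta,\sigma\rangle\ge 0\text{ for all }\theta\in C\}$ be its dual cone. A function $q:\mathbb S^m\to\mathbb R$ is called a Riesz kernel of $f$ with exponent $\alpha$ if it vanishes almost everywhere outside $K$ and, for every $\theta\in C$, the integral below converges absolutely and $$f(\theta)^{-\alpha}=\int_K e^{-\langle\theta,\sigma\rangle}\,q(\sigma)\,d\sigma .$$ Let $$\Gamma_m(\alpha)=\pi^{m(m-1)/4}\prod_{j=1}^m\Gamma\!\left(\alpha-\tfrac{j-1}{2}\right)$$ be the multivariate gamma function. **Proposition.** Let $\alpha>\frac{m-1}{2}$. Then the Riesz kernel of $f$ with exponent $\alpha$ is $$q_\alpha(\sigma)=\frac{1}{\Gamma_m(\alpha)}\,\det(\sigma)^{\alpha-\frac{m+1}{2}}\quad(\sigma\in\mathrm{PD}_m),\qquad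 q_\alpha(\sigma)=0\quad(\sigma\notin\mathrm{PD}_m);$$ that is, a function $q:\mathbb S^m\to\mathbb R$ is a Riesz kernel of $f$ with exponent $\alpha$ if and only if $q=q_\alpha$ almost everywhere. If moreover $\alpha>d$, then for every $\theta\in C$ and every $\sigma\in\mathbb S^m$ the following integral converges absolutely and $$q_\alpha(\sigma)=(2\pi)^{-d}\int_{\mathbb S^m}f(\theta+i\eta)^{-\alpha}\,e^{\langle\theta+i\eta,\sigma\rangle}\,d\eta .$$ Here $f(\theta+i\eta)^{-\alpha}$ is the branch that is continuous on $C+i\,\mathbb S^m$ and positive on $C$, and $d\eta=2^{m(m-1)/2}\prod_{i\le j}d\eta_{ij}$ is Lebesgue measure in the coordinates $\eta_{ii}$, $2\eta_{ij}$ $(i<j)$, which are dual to the coordinates $\sigma_{ij}$ under the trace inner product. -/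

import Mathlib

open MeasureTheory

/-! ## Riesz kernels on `ℝ^ι` -/

section General

variable {ι : Type*}

/-- The dual cone `C^∨ = {σ | ⟨θ, σ⟩ ≥ 0 for all θ ∈ C}` with respect to the pairing `B`. -/
def pairingDualCone (B : LinearMap.BilinForm ℝ (ι → ℝ)) (C : Set (ι → ℝ)) : Set (ι → ℝ) :=
  {σ | ∀ θ ∈ C, 0 ≤ B θ σ}

variable [Fintype ι]

/-- `q` is a Riesz kernel of exponent `α` for the polynomial `f`, the cone `C` and the pairing `B`:
it is supported on `K = C^∨` (up to a null set), and for every `θ ∈ C` the integral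
`∫_K exp(-⟨θ, σ⟩) q(σ) dσ` converges absolutely and equals `f(θ)^(-α)`. Here `dσ` is Lebesgue
measure on `ℝ^ι`. The function `q` is allowed to take negative values. -/
def IsRieszKernel (f : MvPolynomial ι ℝ) (B : LinearMap.BilinForm ℝ (ι → ℝ)) (C : Set (ι → ℝ))
    (α : ℝ) (q : (ι → ℝ) → ℝ) : Prop :=
  (∀ᵐ σ, σ ∉ pairingDualCone B C → q σ = 0) ∧
  ∀ θ ∈ C,
    IntegrableOn (fun σ => Real.exp (-(B θ σ)) * q σ) (pairingDualCone B C) ∧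
    ∫ σ in pairingDualCone B C, Real.exp (-(B θ σ)) * q σ = (MvPolynomial.eval θ f) ^ (-α)

/-- The univariate polynomial `s ↦ f(η + s θ)`. -/
noncomputable def lineRestriction (f : MvPolynomial ι ℝ) (θ η : ι → ℝ) : Polynomial ℝ :=
  MvPolynomial.aeval (fun k => Polynomial.C (η k) + Polynomial.C (θ k) * Polynomial.X) f

/-- The power `f(θ + iη)^(-α)` of a polynomial that is hyperbolic with respect to `θ` and positive
at `θ`. If `r₁, …, r_p` are the roots of `s ↦ f(η + s θ)`, which are all real, then
`f(θ + iη) = f(θ) ∏ (1 - i r_j)`. The factors `1 - i r_j` lie in the right half plane, so taking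
principal powers of them gives the branch of `f(θ + iη)^(-α)` that is continuous in `(θ, η)` and is
the positive number `f(θ)^(-α)` at `η = 0`. -/
noncomputable def hyperbolicNegPow (f : MvPolynomial ι ℝ) (α : ℝ) (θ η : ι → ℝ) : ℂ :=
  (((MvPolynomial.eval θ f) ^ (-α) : ℝ) : ℂ) *
    ((lineRestriction f θ η).roots.map
      (fun r : ℝ => (1 - Complex.I * (r : ℂ)) ^ ((-α : ℝ) : ℂ))).prod

/-- The integrand `f(θ + iη)^(-α) exp(⟨θ + iη, σ⟩)` of Gårding's formula, as a function of `η`. -/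
noncomputable def gardingIntegrand (f : MvPolynomial ι ℝ) (B : LinearMap.BilinForm ℝ (ι → ℝ))
    (α : ℝ) (θ σ η : ι → ℝ) : ℂ :=
  hyperbolicNegPow f α θ η * Complex.exp ((B θ σ : ℂ) + Complex.I * (B η σ : ℂ))

/-- Gårding's integral `(2π)^(-d) ∫ f(θ + iη)^(-α) exp(⟨θ + iη, σ⟩) dη`, `d = |ι|`.
The measure `dη` is Lebesgue measure in the coordinates dual to those of `σ` under the pairing
`⟨θ, σ⟩ = θᵀ S σ`, that is `|det S|` times the product measure `∏ dη_k`; there is no extra factor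
when the pairing is the standard scalar product. -/
noncomputable def gardingIntegral [DecidableEq ι] (f : MvPolynomial ι ℝ)
    (B : LinearMap.BilinForm ℝ (ι → ℝ)) (α : ℝ) (θ σ : ι → ℝ) : ℂ :=
  (((2 * Real.pi) ^ (-(Fintype.card ι : ℝ)) *
      |(LinearMap.BilinForm.toMatrix (Pi.basisFun ℝ ι) B).det| : ℝ) : ℂ) *
    ∫ η, gardingIntegrand f B α θ σ η

end General

/-! ## Symmetric matrices -/

/-- The symmetric `m × m` matrix with the coordinates `x_{ij} = x_{ji}`. Coordinates are indexed by
the unordered pairs `{i, j}`, `i = j` allowed, so `Sym2 (Fin m) → ℝ` is the space of real symmetric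
matrices as `ℝ^(m(m+1)/2)`, with Lebesgue measure `∏_{i ≤ j} dx_{ij}`. -/
def symMat {R : Type*} {m : ℕ} (x : Sym2 (Fin m) → R) : Matrix (Fin m) (Fin m) R :=
  Matrix.of fun i j => x s(i, j)

/-- The determinant of the symmetric `m × m` matrix of unknowns. -/
noncomputable def symDet (m : ℕ) : MvPolynomial (Sym2 (Fin m)) ℝ :=
  (symMat (fun z : Sym2 (Fin m) => (MvPolynomial.X z : MvPolynomial (Sym2 (Fin m)) ℝ))).det

/-- The cone `PD_m` of positive definite matrices. -/
def pdCone (m : ℕ) : Set (Sym2 (Fin m) → ℝ) := {θ | (symMat θ).PosDef}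

/-- The trace inner product `⟨θ, σ⟩ = tr(θ σ)` on symmetric matrices. -/
def traceForm (m : ℕ) : LinearMap.BilinForm ℝ (Sym2 (Fin m) → ℝ) :=
  LinearMap.mk₂ ℝ (fun θ σ => (symMat θ * symMat σ).trace)
    (fun x y z => by
      rw [← Matrix.trace_add, ← add_mul]; rfl)
    (fun c x z => by
      rw [← Matrix.trace_smul, ← Matrix.smul_mul]; rfl)
    (fun x y z => by
      rw [← Matrix.trace_add, ← mul_add]; rfl)
    (fun c x z => by
      rw [← Matrix.trace_smul, ← Matrix.mul_smul]; rfl)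

/-- The multivariate gamma function
`Γ_m(α) = π^(m(m-1)/4) ∏_{j=1}^m Γ(α - (j-1)/2)`. -/
noncomputable def multivariateGamma (m : ℕ) (α : ℝ) : ℝ :=
  Real.pi ^ ((m : ℝ) * ((m : ℝ) - 1) / 4) *
    ∏ j ∈ Finset.Icc 1 m, Real.Gamma (α - ((j : ℝ) - 1) / 2)

/-- The function `σ ↦ det(σ)^(α - (m+1)/2) / Γ_m(α)` on `PD_m`, extended by zero. -/
noncomputable def wishartKernel (m : ℕ) (α : ℝ) : (Sym2 (Fin m) → ℝ) → ℝ :=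
  (pdCone m).indicator fun σ =>
    1 / multivariateGamma m α * (symMat σ).det ^ (α - ((m : ℝ) + 1) / 2)

/-! Existence is Siegel's integral. Write a positive definite matrix with corner `a`, border `b` and
remaining block `s + a⁻¹ b bᵀ`. Then `s` is the Schur complement of `a`: the determinant is `a * det
s`, positive definiteness means `0 < a` and `s` positive definite, and passing from block to Schur
complement is a translation, which preserves Lebesgue measure. The Laplace integrand factors
(`siegelIntegrand_symCons`): the integral over `s` is the same problem in size `n` with exponent `α
- 1/2`, that over `b` is Gaussian, and that over `a` is a Gamma integral. Induction gives
`lintegral_siegelIntegrand`; a finite lower integral of a nonnegative function also yields absolute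
convergence.

Uniqueness and inversion both rest on analytic continuation along lines (`complexMGF_eqOn_strip`).
If two kernels have the same Laplace transform near a point of the cone, continuation to the
imaginary axis makes the Fourier transforms of the exponentially damped kernels equal, so the
kernels agree almost everywhere.

The same continuation identifies the Fourier transform of `exp(-⟨θ, σ⟩) q_α(σ)` with the branch of
`f(θ + iη)^(-α)` (`integral_cexp_mul_wishartKernel`). The eigenvalues of `η` relative to `θ` show
that this decays like `‖η‖^(-α)`, hence is integrable for `α > d`. There `q_α` is also continuous,
since the determinant vanishes on the boundary of the cone, so Fourier inversion holds at every
point. -/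

/-! ### Analytic continuation of moment generating functions -/

open ProbabilityTheory in
/-- If the moment generating function of `X` is given on `(-δ, δ)` by a function `F` that is
holomorphic on the strip `|re z| < δ`, then `F` is the complex moment generating function on it. -/
theorem complexMGF_eqOn_strip {Ω : Type*} [MeasurableSpace Ω] {μ : Measure Ω} {X : Ω → ℝ}
    {F : ℂ → ℂ} {δ : ℝ} (hδ : 0 < δ) (hF : DifferentiableOn ℂ F {z | |z.re| < δ})
    (hint : ∀ t : ℝ, |t| < δ → Integrable (fun ω => Real.exp (t * X ω)) μ)
    (h : ∀ t : ℝ, |t| < δ → ((mgf X μ t : ℝ) : ℂ) = F t) :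
    Set.EqOn (complexMGF X μ) F {z | |z.re| < δ} := by
  have hopen : IsOpen {z : ℂ | |z.re| < δ} :=
    isOpen_lt (by fun_prop) continuous_const
  have hsub : ∀ t : ℝ, |t| < δ → t ∈ interior (integrableExpSet X μ) := by
    intro t ht
    rw [mem_interior]
    exact ⟨{s | |s| < δ}, fun s hs => hint s hs, isOpen_lt (by fun_prop) continuous_const, ht⟩
  have hconv : Convex ℝ {z : ℂ | |z.re| < δ} := by
    have : {z : ℂ | |z.re| < δ} = Complex.reLm ⁻¹' (Metric.ball (0 : ℝ) δ) := by
      ext z; simp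
    rw [this]
    exact (convex_ball 0 δ).linear_preimage _
  refine AnalyticOnNhd.eqOn_of_preconnected_of_frequently_eq (z₀ := 0)
    (fun z hz => analyticAt_complexMGF (hsub _ hz)) (hF.analyticOnNhd hopen)
    hconv.isPreconnected (by simpa using hδ) ?_
  -- Nonzero real points accumulate at `0` in `ℂ`, so agreement on a real interval suffices for the
  -- identity theorem.
  have hlim : Filter.Tendsto (fun t : ℝ => (t : ℂ)) (nhdsWithin 0 {0}ᶜ) (nhdsWithin 0 {0}ᶜ) := by
    refine tendsto_nhdsWithin_of_tendsto_nhds_of_eventually_within _ ?_ ?_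
    · exact ((Complex.continuous_ofReal.tendsto' 0 0 (by simp))).mono_left nhdsWithin_le_nhds
    · filter_upwards [self_mem_nhdsWithin] with t ht
      simpa using ht
  refine hlim.frequently (Filter.Eventually.frequently ?_)
  have : ∀ᶠ t : ℝ in nhds 0, |t| < δ := by
    have := Metric.ball_mem_nhds (0 : ℝ) hδ
    filter_upwards [this] with t ht
    simpa using ht
  filter_upwards [nhdsWithin_le_nhds this] with t ht
  rw [complexMGF_ofReal, h t ht]

/-! ### Uniqueness of Riesz kernels -/

section Uniqueness

variable {ι : Type*} [Fintype ι]

theorem isClosed_pairingDualCone (B : LinearMap.BilinForm ℝ (ι → ℝ)) (C : Set (ι → ℝ)) :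
    IsClosed (pairingDualCone B C) := by
  have : pairingDualCone B C = ⋂ θ ∈ C, {σ | 0 ≤ B θ σ} := by
    ext σ; simp [pairingDualCone]
  rw [this]
  exact isClosed_biInter fun θ _ =>
    isClosed_le continuous_const (B θ).continuous_of_finiteDimensional

open ProbabilityTheory in
/-- A function whose Laplace transform converges absolutely and vanishes along short segments in
every direction vanishes almost everywhere. -/
theorem ae_eq_zero_of_forall_integral_exp_mul_eq_zero {μ : Measure (ι → ℝ)}
    {H : (ι → ℝ) → ℝ} [SigmaFinite μ]
    (hH : ∀ L : StrongDual ℝ (ι → ℝ), ∀ᶠ t : ℝ in nhds 0,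
      Integrable (fun σ => Real.exp (t * L σ) * H σ) μ ∧ ∫ σ, Real.exp (t * L σ) * H σ ∂μ = 0) :
    H =ᵐ[μ] 0 := by
  have hHi : Integrable H μ := by
    have := (hH 0).self_of_nhds.1
    simpa using this
  have hmeas : ∀ s : ℝ, AEMeasurable (fun σ => Real.toNNReal (s * H σ)) μ := fun s =>
    (hHi.aemeasurable.const_mul s).real_toNNReal
  -- `ν 1` and `ν (-1)` have the positive and negative parts of `H` as densities. They are finite
  -- measures, and the claim is that they coincide.
  set ν : ℝ → Measure (ι → ℝ) := fun s =>
    μ.withDensity fun σ => (Real.toNNReal (s * H σ) : ENNReal) with hν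
  have hint : ∀ s : ℝ, ∀ g : (ι → ℝ) → ℝ, AEStronglyMeasurable g μ →
      Integrable (fun σ => g σ * H σ) μ →
      Integrable (fun σ => Real.toNNReal (s * H σ) • g σ) μ := by
    intro s g hgm hg
    refine (hg.const_mul s).mono ?_ (Filter.Eventually.of_forall fun σ => ?_)
    · exact (hmeas s).aestronglyMeasurable.smul hgm
    · rw [NNReal.smul_def, norm_smul, Real.norm_eq_abs, Real.norm_eq_abs, Real.norm_eq_abs]
      rw [show s * (g σ * H σ) = (s * H σ) * g σ by ring, abs_mul (s * H σ)]
      refine mul_le_mul_of_nonneg_right ?_ (abs_nonneg _)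
      rw [Real.coe_toNNReal', abs_of_nonneg (le_max_right _ _)]
      exact max_le (le_abs_self _) (abs_nonneg _)
  have hfin : ∀ s, IsFiniteMeasure (ν s) := by
    intro s
    have h1 : Integrable (fun _ : ι → ℝ => (1 : ℝ)) (ν s) := by
      rw [hν, integrable_withDensity_iff_integrable_smul₀ (hmeas s)]
      exact hint s _ aestronglyMeasurable_const (by simpa using hHi)
    simpa [integrable_const_iff] using h1
  have hexp : ∀ (L : StrongDual ℝ (ι → ℝ)) (t : ℝ),
      AEStronglyMeasurable (fun σ => Real.exp (t * L σ)) μ := fun L t =>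
    (by fun_prop : Continuous fun σ => Real.exp (t * L σ)).aestronglyMeasurable
  have heq : ν 1 = ν (-1) := by
    have := hfin 1
    have := hfin (-1)
    refine Measure.ext_of_charFunDual (funext fun L => ?_)
    obtain ⟨δ, hδ, hL⟩ := Metric.eventually_nhds_iff.1 (hH L)
    have hL' : ∀ t : ℝ, |t| < δ → Integrable (fun σ => Real.exp (t * L σ) * H σ) μ ∧
        ∫ σ, Real.exp (t * L σ) * H σ ∂μ = 0 := fun t ht => hL (by simpa using ht)
    have hi : ∀ s t : ℝ, |t| < δ → Integrable (fun σ => Real.exp (t * L σ)) (ν s) := by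
      intro s t ht
      rw [hν, integrable_withDensity_iff_integrable_smul₀ (hmeas s)]
      exact hint s _ (hexp L t) (hL' t ht).1
    have hmgf : ∀ t : ℝ, |t| < δ → mgf L (ν 1) t = mgf L (ν (-1)) t := by
      intro t ht
      simp only [mgf, hν]
      rw [integral_withDensity_eq_integral_smul₀ (hmeas 1),
        integral_withDensity_eq_integral_smul₀ (hmeas (-1)), ← sub_eq_zero,
        ← integral_sub (hint 1 _ (hexp L t) (hL' t ht).1) (hint (-1) _ (hexp L t) (hL' t ht).1),
        ← (hL' t ht).2]
      refine integral_congr_ae (Filter.Eventually.of_forall fun σ => ?_)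
      simp only [NNReal.smul_def, smul_eq_mul, one_mul, neg_mul, Real.coe_toNNReal']
      rcases le_total 0 (H σ) with h0 | h0
      · rw [max_eq_left h0, max_eq_right (by linarith)]; ring
      · rw [max_eq_right h0, max_eq_left (by linarith)]; ring
    have hstrip : Set.EqOn (complexMGF L (ν 1)) (complexMGF L (ν (-1))) {z | |z.re| < δ} := by
      refine complexMGF_eqOn_strip hδ ?_ (hi 1) fun t ht => ?_
      · refine (differentiableOn_complexMGF (X := L) (μ := ν (-1))).mono fun z hz => ?_
        rw [Set.mem_ofPred_eq, mem_interior]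
        exact ⟨{s | |s| < δ}, fun s hs => hi (-1) s hs,
          isOpen_lt (by fun_prop) continuous_const, hz⟩
      · rw [hmgf t ht, complexMGF_ofReal]
    -- At `z = i` the complex moment generating function is the characteristic function in direction
    -- `L`.
    have := hstrip (show Complex.I ∈ {z : ℂ | |z.re| < δ} by simpa using hδ)
    simpa [complexMGF, charFunDual_apply, mul_comm] using this
  have hae := (withDensity_eq_iff_of_sigmaFinite (hmeas 1).coe_nnreal_ennreal
    (hmeas (-1)).coe_nnreal_ennreal).1 heq
  filter_upwards [hae] with σ hσ
  have h1 : Real.toNNReal (1 * H σ) = Real.toNNReal (-1 * H σ) := by exact_mod_cast hσ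
  have h2 := congrArg NNReal.toReal h1
  simp only [Real.coe_toNNReal', one_mul, neg_mul] at h2
  rcases le_total 0 (H σ) with h0 | h0
  · rw [max_eq_left h0, max_eq_right (by linarith)] at h2; simpa using h2
  · rw [max_eq_right h0, max_eq_left (by linarith)] at h2; simp; linarith

/-- Riesz kernels are unique up to null sets. -/
theorem IsRieszKernel.ae_eq {f : MvPolynomial ι ℝ} {B : LinearMap.BilinForm ℝ (ι → ℝ)}
    {C : Set (ι → ℝ)} {α : ℝ} {q₁ q₂ : (ι → ℝ) → ℝ} {θ : ι → ℝ}
    (hB : ∀ L : (ι → ℝ) →ₗ[ℝ] ℝ, ∃ η, B η = L)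
    (hC : ∀ η, ∀ᶠ t : ℝ in nhds 0, θ + t • η ∈ C)
    (h₁ : IsRieszKernel f B C α q₁) (h₂ : IsRieszKernel f B C α q₂) : q₁ =ᵐ[volume] q₂ := by
  set K := pairingDualCone B C
  have hK : MeasurableSet K := (isClosed_pairingDualCone B C).measurableSet
  -- Damping by `exp(-B θ σ)` moves the base point of the Laplace transform from `θ` to the origin.
  have hzero : (fun σ => Real.exp (-(B θ σ)) * (q₁ σ - q₂ σ)) =ᵐ[volume.restrict K] 0 := by
    refine ae_eq_zero_of_forall_integral_exp_mul_eq_zero fun L => ?_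
    obtain ⟨η, hη⟩ := hB (-(L : (ι → ℝ) →ₗ[ℝ] ℝ))
    filter_upwards [hC η] with t ht
    have hfun : (fun σ => Real.exp (t * L σ) * (Real.exp (-(B θ σ)) * (q₁ σ - q₂ σ))) =
        fun σ => Real.exp (-(B (θ + t • η) σ)) * q₁ σ - Real.exp (-(B (θ + t • η) σ)) * q₂ σ := by
      ext σ
      have : B η σ = - L σ := by rw [hη]; rfl
      rw [map_add, map_smul, LinearMap.add_apply, LinearMap.smul_apply, this, ← mul_assoc,
        ← Real.exp_add, mul_sub]
      simp only [smul_eq_mul]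
      ring_nf
    obtain ⟨hi₁, hv₁⟩ := h₁.2 _ ht
    obtain ⟨hi₂, hv₂⟩ := h₂.2 _ ht
    rw [hfun]
    exact ⟨hi₁.sub hi₂, by rw [integral_sub hi₁ hi₂, hv₁, hv₂, sub_self]⟩
  rw [Filter.EventuallyEq, ae_restrict_iff' hK] at hzero
  filter_upwards [hzero, h₁.1, h₂.1] with σ h0 h1 h2
  by_cases hσ : σ ∈ K
  · have := h0 hσ
    simp only [Pi.zero_apply, mul_eq_zero, Real.exp_ne_zero, false_or] at this
    linarith
  · rw [h1 hσ, h2 hσ]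

end Uniqueness

/-! ### The positive definite cone, the trace form and relative eigenvalues -/

section SymmetricMatrices

open Matrix

variable {m : ℕ}

theorem symMat_isHermitian (x : Sym2 (Fin m) → ℝ) : (symMat x).IsHermitian := by
  ext i j
  simp [symMat, Sym2.eq_swap]

theorem symMat_add (x y : Sym2 (Fin m) → ℝ) : symMat (x + y) = symMat x + symMat y := rfl

theorem symMat_smul (c : ℝ) (x : Sym2 (Fin m) → ℝ) : symMat (c • x) = c • symMat x := rfl

theorem symMat_injective : Function.Injective (symMat : (Sym2 (Fin m) → ℝ) → _) := by
  intro x y h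
  ext z
  induction z using Sym2.ind with
  | _ i j => exact congrFun (congrFun h i) j

theorem continuous_symMat : Continuous (symMat : (Sym2 (Fin m) → ℝ) → _) :=
  continuous_matrix fun _ _ => continuous_apply _

theorem traceForm_apply (θ σ : Sym2 (Fin m) → ℝ) :
    traceForm m θ σ = (symMat θ * symMat σ).trace := rfl

theorem eval_symDet (θ : Sym2 (Fin m) → ℝ) :
    MvPolynomial.eval θ (symDet m) = (symMat θ).det := by
  rw [symDet, RingHom.map_det]
  congr 1
  ext i j
  simp [symMat]

theorem mem_pdCone_iff {θ : Sym2 (Fin m) → ℝ} :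
    θ ∈ pdCone m ↔ ∀ v : Fin m → ℝ, v ≠ 0 → 0 < v ⬝ᵥ (symMat θ *ᵥ v) := by
  change (symMat θ).PosDef ↔ _
  rw [posDef_iff_dotProduct_mulVec, and_iff_right (symMat_isHermitian θ)]
  simp

/-- Positivity of the quadratic form on the compact unit sphere persists under small perturbations
of the matrix; homogeneity extends it to all nonzero vectors. -/
theorem isOpen_pdCone : IsOpen (pdCone m) := by
  rw [isOpen_iff_mem_nhds]
  intro θ hθ
  have h : ∀ᶠ x in nhds θ, ∀ v ∈ Metric.sphere (0 : Fin m → ℝ) 1, 0 < v ⬝ᵥ (symMat x *ᵥ v) := by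
    refine (isCompact_sphere _ _).eventually_forall_of_forall_eventually fun v hv => ?_
    have hv0 : v ≠ 0 := by
      rintro rfl
      simp at hv
    have hcont : Continuous fun p : (Sym2 (Fin m) → ℝ) × (Fin m → ℝ) =>
        p.2 ⬝ᵥ (symMat p.1 *ᵥ p.2) :=
      continuous_snd.dotProduct ((continuous_symMat.comp continuous_fst).matrix_mulVec
        continuous_snd)
    exact hcont.continuousAt.eventually (lt_mem_nhds (mem_pdCone_iff.1 hθ v hv0))
  filter_upwards [h] with x hx
  rw [mem_pdCone_iff]
  intro v hv
  have hn : 0 < ‖v‖ := norm_pos_iff.2 hv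
  have := hx (‖v‖⁻¹ • v) (by simp [norm_smul, hn.ne'])
  rw [mulVec_smul, smul_dotProduct, dotProduct_smul, smul_eq_mul, smul_eq_mul] at this
  have h2 : 0 < ‖v‖⁻¹ := inv_pos.2 hn
  exact (mul_pos_iff_of_pos_left h2).1 ((mul_pos_iff_of_pos_left h2).1 this)

theorem eventually_add_smul_mem_pdCone {θ : Sym2 (Fin m) → ℝ} (hθ : θ ∈ pdCone m)
    (η : Sym2 (Fin m) → ℝ) : ∀ᶠ t : ℝ in nhds 0, θ + t • η ∈ pdCone m := by
  have : Continuous fun t : ℝ => θ + t • η := by fun_prop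
  exact this.continuousAt.eventually_mem (by simpa using isOpen_pdCone.mem_nhds hθ)

theorem Matrix.PosDef.exists_isUnit_transpose_mul_self {n : Type*} [Fintype n] [DecidableEq n]
    {A : Matrix n n ℝ} (hA : A.PosDef) : ∃ P : Matrix n n ℝ, IsUnit P ∧ A = Pᵀ * P := by
  open scoped MatrixOrder in
  obtain ⟨P, hP⟩ := CStarAlgebra.nonneg_iff_eq_star_mul_self.mp hA.posSemidef.nonneg
  rw [star_eq_conjTranspose, conjTranspose_eq_transpose_of_trivial] at hP
  refine ⟨P, ?_, hP⟩
  rw [isUnit_iff_isUnit_det, isUnit_iff_ne_zero]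
  intro h
  have := hA.det_pos
  rw [hP, det_mul, h, mul_zero] at this
  exact this.false

/-- For `θ = PᵀP` the trace of `θσ` equals that of the positive semidefinite matrix `PσPᵀ`. Only
this inclusion is needed: the kernel vanishes outside `pdCone m`, so the dual cone need not be
determined exactly. -/
theorem pdCone_subset_pairingDualCone : pdCone m ⊆ pairingDualCone (traceForm m) (pdCone m) := by
  intro σ hσ θ hθ
  obtain ⟨P, -, hP⟩ := Matrix.PosDef.exists_isUnit_transpose_mul_self hθ
  have hσ' : (symMat σ).PosDef := hσ
  rw [traceForm_apply, hP, Matrix.mul_assoc, Matrix.trace_mul_comm,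
    ← conjTranspose_eq_transpose_of_trivial P]
  exact (hσ'.posSemidef.mul_mul_conjTranspose_same P).trace_nonneg

theorem one_mem_pdCone : (fun z : Sym2 (Fin m) => if z.IsDiag then (1 : ℝ) else 0) ∈ pdCone m := by
  change (symMat _).PosDef
  have : symMat (fun z : Sym2 (Fin m) => if z.IsDiag then (1 : ℝ) else 0) = 1 := by
    ext i j
    simp [symMat, Matrix.one_apply]
  rw [this]
  exact PosDef.one

theorem traceForm_self (σ : Sym2 (Fin m) → ℝ) :
    traceForm m σ σ = ∑ i, ∑ j, symMat σ i j ^ 2 := by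
  rw [traceForm_apply, Matrix.trace]
  refine Finset.sum_congr rfl fun i _ => ?_
  rw [Matrix.diag_apply, Matrix.mul_apply]
  refine Finset.sum_congr rfl fun j _ => ?_
  rw [← (symMat_isHermitian σ).apply i j, star_trivial, sq]

theorem traceForm_injective : Function.Injective (traceForm m) := by
  rw [← LinearMap.ker_eq_bot, LinearMap.ker_eq_bot']
  intro σ hσ
  have h : traceForm m σ σ = 0 := by rw [hσ]; rfl
  rw [traceForm_self] at h
  apply symMat_injective
  ext i j
  have h1 := (Finset.sum_eq_zero_iff_of_nonneg
    (fun i _ => Finset.sum_nonneg fun j _ => sq_nonneg (symMat σ i j))).1 h i (Finset.mem_univ i)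
  have h2 := (Finset.sum_eq_zero_iff_of_nonneg
    (fun j _ => sq_nonneg (symMat σ i j))).1 h1 j (Finset.mem_univ j)
  simpa [symMat] using h2

theorem traceForm_surjective : Function.Surjective (traceForm m) :=
  (LinearMap.injective_iff_surjective_of_finrank_eq_finrank
    (Subspace.dual_finrank_eq (K := ℝ)).symm).1 traceForm_injective

/-- A boundary point of the cone is positive semidefinite but not definite, so its determinant is
`0`; as the exponent is positive, the extension by zero is continuous. -/
theorem continuous_wishartKernel {α : ℝ} (hα : ((m : ℝ) + 1) / 2 < α) :
    Continuous (wishartKernel m α) := by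
  have hdet : Continuous fun σ : Sym2 (Fin m) → ℝ => (symMat σ).det := continuous_symMat.matrix_det
  refine Continuous.indicator (fun σ hσ => ?_) ?_
  · have hcl : σ ∈ closure (pdCone m) := frontier_subset_closure hσ
    have hnot : σ ∉ pdCone m := fun h => by
      rw [isOpen_pdCone.frontier_eq] at hσ
      exact hσ.2 h
    have hpsd : (symMat σ).PosSemidef := by
      refine PosSemidef.of_dotProduct_mulVec_nonneg (symMat_isHermitian σ) fun v => ?_
      have hclosed : IsClosed {x : Sym2 (Fin m) → ℝ | 0 ≤ star v ⬝ᵥ (symMat x *ᵥ v)} :=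
        isClosed_le continuous_const
          (continuous_const.dotProduct (continuous_symMat.matrix_mulVec continuous_const))
      refine closure_minimal (fun x hx => ?_) hclosed hcl
      exact (show (symMat x).PosDef from hx).posSemidef.dotProduct_mulVec_nonneg v
    have h0 : (symMat σ).det = 0 := by
      by_contra h
      exact hnot (hpsd.posDef_iff_det_ne_zero.2 h)
    rw [h0, Real.zero_rpow (by linarith), mul_zero]
  · exact continuous_const.mul (hdet.rpow_const fun _ => Or.inr (by linarith))

theorem Matrix.IsHermitian.det_smul_one_add_smul {n : Type*} [Fintype n] [DecidableEq n]
    {N : Matrix n n ℝ} (hN : N.IsHermitian) (s t : ℝ) :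
    (s • (1 : Matrix n n ℝ) + t • N).det = ∏ j, (s + t * hN.eigenvalues j) := by
  set U : Matrix n n ℝ := (hN.eigenvectorUnitary : Matrix n n ℝ) with hU
  have hUU : U * star U = 1 := Unitary.coe_mul_star_self hN.eigenvectorUnitary
  have hsp : N = U * diagonal hN.eigenvalues * star U := by
    conv_lhs => rw [hN.spectral_theorem]
    rfl
  have : s • (1 : Matrix n n ℝ) + t • N =
      U * diagonal (fun j => s + t * hN.eigenvalues j) * star U := by
    have hd : diagonal (fun j => s + t * hN.eigenvalues j) =
        s • (1 : Matrix n n ℝ) + t • diagonal hN.eigenvalues := by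
      ext i j
      by_cases h : i = j <;> simp [h]
    rw [hd, mul_add, add_mul]
    simp only [Matrix.mul_smul, Matrix.smul_mul, mul_one]
    rw [hUU, ← hsp]
  rw [this, det_mul, det_mul, mul_comm, ← mul_assoc, ← det_mul]
  rw [show star U * U = 1 from Unitary.coe_star_mul_self hN.eigenvectorUnitary]
  simp [det_diagonal]

theorem Matrix.IsHermitian.sum_sq_eigenvalues {n : Type*} [Fintype n] [DecidableEq n]
    {N : Matrix n n ℝ} (hN : N.IsHermitian) :
    ∑ j, hN.eigenvalues j ^ 2 = ∑ i, ∑ j, N i j ^ 2 := by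
  set U : Matrix n n ℝ := (hN.eigenvectorUnitary : Matrix n n ℝ) with hU
  have hUU : star U * U = 1 := Unitary.coe_star_mul_self hN.eigenvectorUnitary
  have hsp : N = U * diagonal hN.eigenvalues * star U := by
    conv_lhs => rw [hN.spectral_theorem]
    rfl
  have h1 : (N * N).trace = ∑ i, ∑ j, N i j ^ 2 := by
    refine Finset.sum_congr rfl fun i _ => ?_
    rw [Matrix.diag_apply, Matrix.mul_apply]
    refine Finset.sum_congr rfl fun j _ => ?_
    rw [← hN.apply i j, star_trivial, sq]
  rw [← h1]
  have h2 : N * N = U * (diagonal hN.eigenvalues * diagonal hN.eigenvalues) * star U := by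
    conv_lhs => rw [hsp]
    calc _ = U * diagonal hN.eigenvalues * (star U * U) * diagonal hN.eigenvalues * star U := by
            simp only [Matrix.mul_assoc]
      _ = _ := by rw [hUU, mul_one]; simp only [Matrix.mul_assoc]
  rw [h2, Matrix.trace_mul_comm, ← Matrix.mul_assoc, hUU, one_mul, diagonal_mul_diagonal,
    trace_diagonal]
  simp [sq]

/-- The pencil `s θ + t η` with `θ` positive definite has real generalized eigenvalues, and their
sum of squares is the square of a Euclidean norm of `η`. -/
theorem exists_pencil_eigenvalues {θ : Sym2 (Fin m) → ℝ} (hθ : θ ∈ pdCone m) :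
    ∃ c : ℝ, 0 < c ∧ ∀ η : Sym2 (Fin m) → ℝ, ∃ ev : Fin m → ℝ,
      (∀ s t : ℝ, (symMat (s • θ + t • η)).det = (symMat θ).det * ∏ j, (s + t * ev j)) ∧
      c * ‖η‖ ^ 2 ≤ ∑ j, ev j ^ 2 := by
  obtain ⟨P, hPu, hP⟩ := Matrix.PosDef.exists_isUnit_transpose_mul_self hθ
  have hdet : IsUnit P.det := (isUnit_iff_isUnit_det P).1 hPu
  have hdetT : IsUnit Pᵀ.det := by rwa [det_transpose]
  -- Congruence by `P⁻¹` turns `θ = PᵀP` into the identity and `η` into a symmetric matrix, whose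
  -- ordinary eigenvalues are those of `η` relative to `θ`.
  set N : (Sym2 (Fin m) → ℝ) → Matrix (Fin m) (Fin m) ℝ :=
    fun η => (P⁻¹)ᵀ * symMat η * P⁻¹ with hNdef
  have hPN : ∀ η, Pᵀ * N η * P = symMat η := by
    intro η
    calc Pᵀ * N η * P = (Pᵀ * (Pᵀ)⁻¹) * symMat η * (P⁻¹ * P) := by
          rw [hNdef, transpose_nonsing_inv]; simp only [Matrix.mul_assoc]
      _ = _ := by rw [mul_nonsing_inv _ hdetT, nonsing_inv_mul _ hdet, one_mul, mul_one]
  have hN : ∀ η, (N η).IsHermitian := by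
    intro η
    have := isHermitian_conjTranspose_mul_mul (P⁻¹) (symMat_isHermitian η)
    rwa [conjTranspose_eq_transpose_of_trivial] at this
  let f : (Sym2 (Fin m) → ℝ) →ₗ[ℝ] (Fin m × Fin m → ℝ) :=
    { toFun := fun η p => N η p.1 p.2
      map_add' := fun x y => by
        ext p
        simp [hNdef, symMat_add, mul_add, add_mul]
      map_smul' := fun a x => by
        ext p
        simp [hNdef, symMat_smul] }
  -- An injective linear map on a finite-dimensional space is bounded below; this supplies the
  -- constant `c = K⁻²`.
  have hf : LinearMap.ker f = ⊥ := by
    rw [LinearMap.ker_eq_bot]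
    intro x y hxy
    apply symMat_injective
    have : N x = N y := by
      ext i j
      exact congrFun hxy (i, j)
    rw [← hPN x, ← hPN y, this]
  obtain ⟨K, hK, hKf⟩ := f.exists_antilipschitzWith hf
  have hK' : (0 : ℝ) < K := hK
  refine ⟨((K : ℝ) ^ 2)⁻¹, by positivity, fun η => ⟨(hN η).eigenvalues, fun s t => ?_, ?_⟩⟩
  · rw [← (hN η).det_smul_one_add_smul]
    have : symMat (s • θ + t • η) = Pᵀ * (s • (1 : Matrix (Fin m) (Fin m) ℝ) + t • N η) * P := by
      rw [symMat_add, symMat_smul, symMat_smul, mul_add, add_mul]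
      simp only [Matrix.mul_smul, Matrix.smul_mul, mul_one]
      rw [hPN, hP]
    rw [this, hP, det_mul, det_mul, det_mul]
    ring
  · rw [(hN η).sum_sq_eigenvalues]
    have h1 : ‖η‖ ≤ K * ‖f η‖ := by
      have := hKf.le_mul_dist η 0
      simpa using this
    have h2 : ‖f η‖ ^ 2 ≤ ∑ p : Fin m × Fin m, f η p ^ 2 := by
      have h3 : ‖f η‖ ≤ √(∑ p : Fin m × Fin m, f η p ^ 2) := by
        rw [pi_norm_le_iff_of_nonneg (Real.sqrt_nonneg _)]
        intro p
        rw [Real.norm_eq_abs]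
        apply Real.abs_le_sqrt
        exact Finset.single_le_sum (f := fun p => f η p ^ 2) (fun p _ => sq_nonneg _)
          (Finset.mem_univ p)
      calc ‖f η‖ ^ 2 ≤ (√(∑ p : Fin m × Fin m, f η p ^ 2)) ^ 2 := by gcongr
        _ = _ := Real.sq_sqrt (Finset.sum_nonneg fun p _ => sq_nonneg _)
    rw [Fintype.sum_prod_type] at h2
    calc ((K : ℝ) ^ 2)⁻¹ * ‖η‖ ^ 2 ≤ ((K : ℝ) ^ 2)⁻¹ * (K * ‖f η‖) ^ 2 := by gcongr
      _ = ‖f η‖ ^ 2 := by field_simp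
      _ ≤ _ := h2

theorem eval_lineRestriction {ι : Type*} (f : MvPolynomial ι ℝ) (θ η : ι → ℝ) (s : ℝ) :
    (lineRestriction f θ η).eval s = MvPolynomial.eval (s • θ + η) f := by
  rw [lineRestriction, MvPolynomial.aeval_def, ← Polynomial.coe_evalRingHom,
    MvPolynomial.hom_eval₂, MvPolynomial.eval, MvPolynomial.coe_eval₂Hom]
  congr 1
  · ext x
    simp
  · ext k
    simp
    ring

/-- The branch `f(θ + iη)^(-α)` in terms of the eigenvalues of `η` relative to `θ`. -/
theorem hyperbolicNegPow_symDet {θ η : Sym2 (Fin m) → ℝ} {ev : Fin m → ℝ} (hθ : θ ∈ pdCone m)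
    (hev : ∀ s t : ℝ, (symMat (s • θ + t • η)).det = (symMat θ).det * ∏ j, (s + t * ev j)) (α : ℝ) :
    hyperbolicNegPow (symDet m) α θ η =
      (((symMat θ).det ^ (-α) : ℝ) : ℂ) * ∏ j, (1 + Complex.I * ev j) ^ ((-α : ℝ) : ℂ) := by
  have hpos : 0 < (symMat θ).det := PosDef.det_pos hθ
  have hline : lineRestriction (symDet m) θ η =
      Polynomial.C (symMat θ).det * ∏ j, (Polynomial.X - Polynomial.C (-ev j)) := by
    refine Polynomial.funext fun s => ?_
    have := hev s 1
    simp only [one_smul, one_mul] at this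
    rw [eval_lineRestriction, eval_symDet, this]
    simp [Polynomial.eval_prod]
  -- The roots are the negatives of the relative eigenvalues, so each factor `1 - i r` becomes `1 +
  -- i ev j`.
  have hroots : (lineRestriction (symDet m) θ η).roots =
      Finset.univ.val.map fun j => -ev j := by
    rw [hline, Polynomial.roots_C_mul _ hpos.ne', Polynomial.roots_prod _ _
      (Finset.prod_ne_zero_iff.2 fun j _ => Polynomial.X_sub_C_ne_zero _)]
    simp only [Polynomial.roots_X_sub_C, Multiset.bind_singleton]
  rw [hyperbolicNegPow, eval_symDet, hroots, Multiset.map_map]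
  simp [Finset.prod]

theorem one_add_sum_le_prod_one_add {ι : Type*} (s : Finset ι) {a : ι → ℝ} (ha : ∀ i, 0 ≤ a i) :
    1 + ∑ i ∈ s, a i ≤ ∏ i ∈ s, (1 + a i) := by
  classical
  induction s using Finset.induction_on with
  | empty => simp
  | insert i s hi ih =>
    rw [Finset.sum_insert hi, Finset.prod_insert hi]
    have := Finset.sum_nonneg fun j (_ : j ∈ s) => ha j
    nlinarith [ha i, mul_nonneg (ha i) this, mul_le_mul_of_nonneg_left ih (ha i)]

/-- Since `|1 + i x|² = 1 + x²`, the modulus is governed by `∏ (1 + ev j ^ 2)`, which is at least `1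
+ ∑ ev j ^ 2` and so controls a multiple of `‖η‖²`. -/
theorem norm_hyperbolicNegPow_symDet_le {θ : Sym2 (Fin m) → ℝ} (hθ : θ ∈ pdCone m) {α : ℝ}
    (hα : 0 ≤ α) : ∃ c : ℝ, 0 < c ∧ ∀ η, ‖hyperbolicNegPow (symDet m) α θ η‖ ≤
      (symMat θ).det ^ (-α) * (1 + ‖c • η‖ ^ 2) ^ (-α / 2) := by
  obtain ⟨c, hc, h⟩ := exists_pencil_eigenvalues hθ
  have hpos : 0 < (symMat θ).det := PosDef.det_pos hθ
  refine ⟨√c, Real.sqrt_pos.2 hc, fun η => ?_⟩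
  obtain ⟨ev, hev, hsum⟩ := h η
  rw [hyperbolicNegPow_symDet hθ hev, norm_mul, Complex.norm_real, Real.norm_of_nonneg
    (Real.rpow_nonneg hpos.le _)]
  refine mul_le_mul_of_nonneg_left ?_ (Real.rpow_nonneg hpos.le _)
  have hterm : ∀ j, ‖(1 + Complex.I * (ev j : ℂ)) ^ ((-α : ℝ) : ℂ)‖ =
      (1 + ev j ^ 2) ^ (-α / 2) := by
    intro j
    rw [Complex.norm_cpow_real, Complex.norm_def, Real.sqrt_eq_rpow, ← Real.rpow_mul
      (Complex.normSq_nonneg _)]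
    congr 1
    · simp [Complex.normSq_apply]; ring
    · ring
  rw [norm_prod, Finset.prod_congr rfl fun j _ => hterm j,
    Real.finsetProd_rpow _ _ fun j _ => by positivity]
  refine Real.rpow_le_rpow_of_nonpos (by positivity) ?_ (by linarith)
  rw [norm_smul, mul_pow, Real.norm_eq_abs, sq_abs, Real.sq_sqrt hc.le]
  calc 1 + c * ‖η‖ ^ 2 ≤ 1 + ∑ j, ev j ^ 2 := by gcongr
    _ ≤ _ := one_add_sum_le_prod_one_add _ fun j => sq_nonneg _

end SymmetricMatrices

/-! ### Bordered coordinates and Schur complements -/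

section BorderedCoordinates

open Matrix

variable {n : ℕ}

/-- The unordered pairs in `Fin (n + 1)`: those that contain `0`, and those that do not. -/
noncomputable def sym2FinSuccEquiv (n : ℕ) : Fin (n + 1) ⊕ Sym2 (Fin n) ≃ Sym2 (Fin (n + 1)) :=
  Equiv.ofBijective (Sum.elim (fun k => s(0, k)) (Sym2.map Fin.succ)) <| by
    constructor
    · rintro (k | z) (l | w) h
      · simp only [Sum.elim_inl, Sym2.eq_iff] at h
        rcases h with ⟨-, h⟩ | ⟨h1, h2⟩
        · rw [h]
        · rw [h2, ← h1]
      · induction w using Sym2.ind with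
        | _ i j =>
          simp [(Fin.succ_ne_zero _).symm] at h
      · induction z using Sym2.ind with
        | _ i j =>
          simp [Fin.succ_ne_zero] at h
      · rw [Sym2.map.injective (Fin.succ_injective n) h]
    · intro z
      induction z using Sym2.ind with
      | _ i j =>
        induction i using Fin.cases with
        | zero => exact ⟨Sum.inl j, rfl⟩
        | succ i =>
          induction j using Fin.cases with
          | zero => exact ⟨Sum.inl i.succ, Sym2.eq_swap⟩
          | succ j => exact ⟨Sum.inr s(i, j), rfl⟩

/-- The symmetric matrix with first diagonal entry `a`, remaining first row `b` and remaining
block `s`. -/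
noncomputable def symCons (a : ℝ) (b : Fin n → ℝ) (s : Sym2 (Fin n) → ℝ) :
    Sym2 (Fin (n + 1)) → ℝ :=
  fun z => Sum.elim (Fin.cons a b : Fin (n + 1) → ℝ) s ((sym2FinSuccEquiv n).symm z)

theorem symCons_inl (a : ℝ) (b : Fin n → ℝ) (s : Sym2 (Fin n) → ℝ) (k : Fin (n + 1)) :
    symCons a b s s(0, k) = (Fin.cons a b : Fin (n + 1) → ℝ) k := by
  rw [symCons, show s(0, k) = sym2FinSuccEquiv n (Sum.inl k) from rfl, Equiv.symm_apply_apply]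
  rfl

theorem symCons_inr (a : ℝ) (b : Fin n → ℝ) (s : Sym2 (Fin n) → ℝ) (i j : Fin n) :
    symCons a b s s(i.succ, j.succ) = s s(i, j) := by
  rw [symCons, show s(i.succ, j.succ) = sym2FinSuccEquiv n (Sum.inr s(i, j)) from rfl,
    Equiv.symm_apply_apply]
  rfl

theorem exists_eq_symCons (x : Sym2 (Fin (n + 1)) → ℝ) : ∃ a b s, x = symCons a b s := by
  refine ⟨x s(0, 0), fun i => x s(0, i.succ), fun z => x (z.map Fin.succ), ?_⟩
  ext z
  induction z using Sym2.ind with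
  | _ i j =>
    induction i using Fin.cases with
    | zero =>
      rw [symCons_inl]
      induction j using Fin.cases with
      | zero => rfl
      | succ j => rfl
    | succ i =>
      induction j using Fin.cases with
      | zero => rw [Sym2.eq_swap, symCons_inl]; rfl
      | succ j => rw [symCons_inr]; rfl

theorem symMat_symCons_zero_zero (a : ℝ) (b : Fin n → ℝ) (s : Sym2 (Fin n) → ℝ) :
    symMat (symCons a b s) 0 0 = a := symCons_inl a b s 0

theorem symMat_symCons_zero_succ (a : ℝ) (b : Fin n → ℝ) (s : Sym2 (Fin n) → ℝ) (i : Fin n) :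
    symMat (symCons a b s) 0 i.succ = b i := symCons_inl a b s i.succ

theorem symMat_symCons_succ_zero (a : ℝ) (b : Fin n → ℝ) (s : Sym2 (Fin n) → ℝ) (i : Fin n) :
    symMat (symCons a b s) i.succ 0 = b i := by
  change symCons a b s s(i.succ, 0) = b i
  rw [Sym2.eq_swap]
  exact symCons_inl a b s i.succ

theorem symMat_symCons_succ_succ (a : ℝ) (b : Fin n → ℝ) (s : Sym2 (Fin n) → ℝ) (i j : Fin n) :
    symMat (symCons a b s) i.succ j.succ = symMat s i j := symCons_inr a b s i j

/-- Tonelli's theorem: bordering only regroups the coordinates, so Lebesgue measure becomes `da db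
ds` without a Jacobian factor. -/
theorem lintegral_symCons (F : (Sym2 (Fin (n + 1)) → ℝ) → ENNReal) (hF : Measurable F) :
    ∫⁻ x, F x = ∫⁻ a : ℝ, ∫⁻ b : Fin n → ℝ, ∫⁻ s : Sym2 (Fin n) → ℝ, F (symCons a b s) := by
  have h1 := (volume_measurePreserving_piCongrLeft (fun _ => ℝ) (sym2FinSuccEquiv n))
  have h2 := volume_measurePreserving_sumPiEquivProdPi_symm
    (fun _ : Fin (n + 1) ⊕ Sym2 (Fin n) => ℝ)
  have h3 := (volume_preserving_piFinSuccAbove (fun _ : Fin (n + 1) => ℝ) 0).symm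
  have h12 := h1.comp h2
  set Φ := (MeasurableEquiv.piCongrLeft (fun _ => ℝ) (sym2FinSuccEquiv n)) ∘
    (MeasurableEquiv.sumPiEquivProdPi (fun _ : Fin (n + 1) ⊕ Sym2 (Fin n) => ℝ)).symm with hΦ
  have hval : ∀ a b s, Φ (((MeasurableEquiv.piFinSuccAbove (fun _ : Fin (n + 1) => ℝ) 0).symm
      (a, b)), s) = symCons a b s := by
    intro a b s
    ext z
    obtain ⟨w, rfl⟩ := (sym2FinSuccEquiv n).surjective z
    rw [hΦ, Function.comp_apply, MeasurableEquiv.piCongrLeft_apply_apply, symCons,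
      Equiv.symm_apply_apply]
    rcases w with k | w
    · change (Fin.insertNth (0 : Fin (n + 1)) a b : Fin (n + 1) → ℝ) k = _
      rw [Fin.insertNth_zero']
      rfl
    · rfl
  have hm : Measurable fun p => F (Φ p) := hF.comp h12.measurable
  rw [← h12.lintegral_comp hF, Measure.volume_eq_prod, lintegral_prod _ hm.aemeasurable,
    ← h3.lintegral_comp hm.lintegral_prod_right', Measure.volume_eq_prod, lintegral_prod]
  · simp_rw [hval]
  · exact (hm.lintegral_prod_right'.comp h3.measurable).aemeasurable

/-- The rank one symmetric matrix `b bᵀ`. -/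
def symOuter (b : Fin n → ℝ) : Sym2 (Fin n) → ℝ :=
  Sym2.lift ⟨fun i j => b i * b j, fun _ _ => mul_comm _ _⟩

theorem symMat_symOuter (b : Fin n → ℝ) : symMat (symOuter b) = vecMulVec b b := rfl

theorem traceForm_symOuter (θ : Sym2 (Fin n) → ℝ) (b : Fin n → ℝ) :
    traceForm n θ (symOuter b) = b ⬝ᵥ (symMat θ *ᵥ b) := by
  rw [traceForm_apply, symMat_symOuter, mul_vecMulVec, trace_vecMulVec, dotProduct_comm]

theorem traceForm_symCons (a a' : ℝ) (b b' : Fin n → ℝ) (s s' : Sym2 (Fin n) → ℝ) :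
    traceForm (n + 1) (symCons a b s) (symCons a' b' s') =
      a * a' + 2 * (b ⬝ᵥ b') + traceForm n s s' := by
  simp only [traceForm_apply, Matrix.trace, Matrix.diag_apply, Matrix.mul_apply, dotProduct,
    Fin.sum_univ_succ, symMat_symCons_zero_zero, symMat_symCons_zero_succ,
    symMat_symCons_succ_zero, symMat_symCons_succ_succ, Finset.sum_add_distrib]
  ring

theorem quadForm_symCons (a : ℝ) (b : Fin n → ℝ) (s : Sym2 (Fin n) → ℝ) (v : Fin (n + 1) → ℝ) :
    v ⬝ᵥ (symMat (symCons a b s) *ᵥ v) =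
      a * v 0 ^ 2 + 2 * v 0 * (b ⬝ᵥ Fin.tail v) + Fin.tail v ⬝ᵥ (symMat s *ᵥ Fin.tail v) := by
  simp only [dotProduct, mulVec, Fin.sum_univ_succ, symMat_symCons_zero_zero,
    symMat_symCons_zero_succ, symMat_symCons_succ_zero, symMat_symCons_succ_succ, Fin.tail,
    mul_add, Finset.sum_add_distrib, Finset.mul_sum]
  have : ∑ i, v i.succ * (b i * v 0) = ∑ i, v 0 * (b i * v i.succ) :=
    Finset.sum_congr rfl fun i _ => by ring
  rw [this]
  have : ∑ i, 2 * v 0 * (b i * v i.succ) = 2 * ∑ i, v 0 * (b i * v i.succ) := by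
    rw [Finset.mul_sum]
    exact Finset.sum_congr rfl fun i _ => by ring
  rw [this]
  ring

theorem pos_of_symCons_mem_pdCone {a : ℝ} {b : Fin n → ℝ} {s : Sym2 (Fin n) → ℝ}
    (h : symCons a b s ∈ pdCone (n + 1)) : 0 < a := by
  have hp : (symMat (symCons a b s)).PosDef := h
  have := hp.diag_pos (i := 0)
  rwa [symMat_symCons_zero_zero] at this

theorem block_mem_pdCone_of_symCons {a : ℝ} {b : Fin n → ℝ} {s : Sym2 (Fin n) → ℝ}
    (h : symCons a b s ∈ pdCone (n + 1)) : s ∈ pdCone n := by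
  rw [mem_pdCone_iff] at h ⊢
  intro v hv
  have := h (Fin.cons 0 v) fun h0 => hv (by
    have := congrArg Fin.tail h0
    rwa [Fin.tail_cons] at this)
  rw [quadForm_symCons] at this
  simpa using this

/-- Completing the square in the first variable leaves exactly the quadratic form of the Schur
complement `s`. -/
theorem symCons_add_symOuter_mem_pdCone_iff {a : ℝ} (ha : 0 < a) (b : Fin n → ℝ)
    (s : Sym2 (Fin n) → ℝ) :
    symCons a b (s + a⁻¹ • symOuter b) ∈ pdCone (n + 1) ↔ s ∈ pdCone n := by
  have key : ∀ v : Fin (n + 1) → ℝ,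
      v ⬝ᵥ (symMat (symCons a b (s + a⁻¹ • symOuter b)) *ᵥ v) =
        a * (v 0 + a⁻¹ * (b ⬝ᵥ Fin.tail v)) ^ 2 + Fin.tail v ⬝ᵥ (symMat s *ᵥ Fin.tail v) := by
    intro v
    rw [quadForm_symCons, symMat_add, symMat_smul, symMat_symOuter, add_mulVec, smul_mulVec,
      vecMulVec_mulVec, dotProduct_add, dotProduct_smul, op_smul_eq_smul, dotProduct_smul,
      dotProduct_comm (Fin.tail v) b]
    simp only [smul_eq_mul]
    field_simp
    ring
  rw [mem_pdCone_iff, mem_pdCone_iff]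
  constructor
  · intro h w hw
    -- The first coordinate is chosen to make the completed square vanish.
    have := h (Fin.cons (-(a⁻¹ * (b ⬝ᵥ w))) w) fun h0 => hw (by
      have := congrArg Fin.tail h0
      rwa [Fin.tail_cons] at this)
    rw [key] at this
    simpa using this
  · intro h v hv
    rw [key]
    by_cases ht : Fin.tail v = 0
    · have hv0 : v 0 ≠ 0 := by
        intro h0
        apply hv
        rw [← Fin.cons_self_tail v, ht, h0]
        ext i
        refine Fin.cases ?_ (fun j => ?_) i <;> rfl
      rw [ht]
      simp only [dotProduct_zero, mul_zero, add_zero, mulVec_zero]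
      positivity
    · exact add_pos_of_nonneg_of_pos (by positivity) (h _ ht)

/-- The determinant of a bordered symmetric matrix, as that of a block matrix. -/
theorem det_symMat_symCons (a : ℝ) (b : Fin n → ℝ) (s : Sym2 (Fin n) → ℝ) :
    (symMat (symCons a b s)).det =
      (fromBlocks (of fun _ _ : Unit => a) (replicateRow Unit b) (replicateCol Unit b)
        (symMat s)).det := by
  let e : Unit ⊕ Fin n ≃ Fin (n + 1) :=
    (Equiv.sumComm _ _).trans ((Equiv.optionEquivSumPUnit (Fin n)).symm.trans
      (finSuccEquiv n).symm)
  rw [← det_submatrix_equiv_self e]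
  congr 1
  ext (i | i) (j | j)
  · exact symMat_symCons_zero_zero a b s
  · exact symMat_symCons_zero_succ a b s j
  · exact symMat_symCons_succ_zero a b s i
  · exact symMat_symCons_succ_succ a b s i j

/-- Block elimination with pivot `a`; this form serves the integration variable. -/
theorem det_symMat_symCons_add_symOuter {a : ℝ} (ha : a ≠ 0) (b : Fin n → ℝ)
    (s : Sym2 (Fin n) → ℝ) :
    (symMat (symCons a b (s + a⁻¹ • symOuter b))).det = a * (symMat s).det := by
  have : fromBlocks (of fun _ _ : Unit => a) (replicateRow Unit b) (replicateCol Unit b)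
        (symMat (s + a⁻¹ • symOuter b)) =
      fromBlocks 1 0 (replicateCol Unit (a⁻¹ • b)) 1 *
        fromBlocks (of fun _ _ : Unit => a) (replicateRow Unit b) 0 (symMat s) := by
    rw [fromBlocks_multiply]
    congr 1
    · simp
    · simp
    · ext i j
      simp [Matrix.mul_apply]
      field_simp
    · ext i j
      simp [Matrix.mul_apply, symMat_add, symMat_smul, symMat_symOuter, vecMulVec_apply]
      ring
  rw [det_symMat_symCons, this, det_mul, det_fromBlocks_zero₁₂, det_fromBlocks_zero₂₁]
  simp

/-- Block elimination with the large block as pivot, which serves the parameter `θ`. The vector `u`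
stands for `s⁻¹ b`, so no inverse matrix occurs. -/
theorem det_symMat_symCons_of_mulVec_eq {a : ℝ} {b u : Fin n → ℝ} {s : Sym2 (Fin n) → ℝ}
    (hu : symMat s *ᵥ u = b) :
    (symMat (symCons a b s)).det = (a - b ⬝ᵥ u) * (symMat s).det := by
  have : fromBlocks (of fun _ _ : Unit => a) (replicateRow Unit b) (replicateCol Unit b)
        (symMat s) =
      fromBlocks 1 (replicateRow Unit u) 0 1 *
        fromBlocks (of fun _ _ : Unit => a - b ⬝ᵥ u) 0 (replicateCol Unit b) (symMat s) := by
    rw [fromBlocks_multiply]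
    congr 1
    · ext i j
      simp [Matrix.mul_apply, dotProduct, mul_comm]
    · ext i j
      have := congrFun hu j
      simp only [mulVec, dotProduct] at this
      simp only [replicateRow_apply, Matrix.mul_apply, ← this, Matrix.add_apply,
        Matrix.mul_zero, Matrix.zero_apply, zero_add]
      refine Finset.sum_congr rfl fun k _ => ?_
      rw [← (symMat_isHermitian s).apply k j, star_trivial, mul_comm]
    · simp
    · simp
  rw [det_symMat_symCons, this, det_mul, det_fromBlocks_zero₁₂, det_fromBlocks_zero₂₁]
  simp

theorem sub_dotProduct_pos_of_symCons_mem_pdCone {a : ℝ} {b u : Fin n → ℝ}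
    {s : Sym2 (Fin n) → ℝ} (hu : symMat s *ᵥ u = b) (h : symCons a b s ∈ pdCone (n + 1)) :
    0 < a - b ⬝ᵥ u := by
  -- At the vector `(1, -u)` the quadratic form is `a - 2 b·u + u·su = a - b·u`.
  have := mem_pdCone_iff.1 h (Fin.cons 1 (-u)) fun h0 => by
    have := congrFun h0 0
    simp at this
  rw [quadForm_symCons] at this
  simp only [Fin.cons_zero, Fin.tail_cons, mulVec_neg, hu, dotProduct_neg, neg_dotProduct,
    dotProduct_comm u b] at this
  linarith

end BorderedCoordinates

/-! ### Gaussian and Gamma integrals, and Siegel's integral -/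

section SiegelIntegral

open Matrix

theorem lintegral_exp_neg_mul_sum_sq {n : ℕ} {r : ℝ} (hr : 0 < r) :
    ∫⁻ x : Fin n → ℝ, ENNReal.ofReal (Real.exp (-r * ∑ i, x i ^ 2)) =
      ENNReal.ofReal ((Real.pi / r) ^ ((n : ℝ) / 2)) := by
  have hfun : (fun x : Fin n → ℝ => Real.exp (-r * ∑ i, x i ^ 2)) =
      fun x => ∏ i, Real.exp (-r * x i ^ 2) := by
    ext x
    rw [Finset.mul_sum, Real.exp_sum]
  have hint : Integrable fun x : Fin n → ℝ => Real.exp (-r * ∑ i, x i ^ 2) := by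
    rw [hfun]
    exact Integrable.fintype_prod (f := fun _ x => Real.exp (-r * x ^ 2))
      fun _ => integrable_exp_neg_mul_sq hr
  rw [← ofReal_integral_eq_lintegral_ofReal hint
    (Filter.Eventually.of_forall fun _ => (Real.exp_pos _).le), hfun,
    integral_fintype_prod_volume_eq_pow (fun x => Real.exp (-r * x ^ 2)), integral_gaussian,
    Fintype.card_fin, Real.sqrt_eq_rpow, ← Real.rpow_natCast, ← Real.rpow_mul (by positivity)]
  congr 2
  ring

/-- With `A = PᵀP`, the substitution `y = Px` reduces to the standard Gaussian; its Jacobian is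
`|det P|⁻¹ = det A ^ (-1/2)`. -/
theorem lintegral_exp_neg_quadForm {n : ℕ} {A : Matrix (Fin n) (Fin n) ℝ} (hA : A.PosDef) {r : ℝ}
    (hr : 0 < r) :
    ∫⁻ x : Fin n → ℝ, ENNReal.ofReal (Real.exp (-r * (x ⬝ᵥ (A *ᵥ x)))) =
      ENNReal.ofReal ((Real.pi / r) ^ ((n : ℝ) / 2) * A.det ^ (-(1 / 2) : ℝ)) := by
  obtain ⟨P, hPu, hP⟩ := hA.exists_isUnit_transpose_mul_self
  have hdet : P.det ≠ 0 := isUnit_iff_ne_zero.1 ((isUnit_iff_isUnit_det P).1 hPu)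
  have hq : ∀ x, x ⬝ᵥ (A *ᵥ x) = ∑ i, (toLin' P x) i ^ 2 := by
    intro x
    rw [hP, ← mulVec_mulVec, dotProduct_mulVec, vecMul_transpose, toLin'_apply]
    simp [dotProduct, sq]
  have hm : Measurable fun x : Fin n → ℝ => ENNReal.ofReal (Real.exp (-r * ∑ i, x i ^ 2)) := by
    fun_prop
  have hL : Measurable (toLin' P) := (toLin' P).continuous_of_finiteDimensional.measurable
  simp_rw [hq]
  rw [← lintegral_map hm hL, Real.map_matrix_volume_pi_eq_smul_volume_pi hdet,
    lintegral_smul_measure, lintegral_exp_neg_mul_sum_sq hr, smul_eq_mul,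
    ← ENNReal.ofReal_mul (abs_nonneg _), mul_comm]
  congr 2
  rw [hP, det_mul, det_transpose, ← sq, ← sq_abs, ← Real.rpow_natCast, ← Real.rpow_mul
    (abs_nonneg _), abs_inv]
  norm_num [Real.rpow_neg_one]

/-- Complete the square about the centre `-r u`. In Siegel's integral this is the integral over the
border, with `r` the corner entry. -/
theorem lintegral_exp_neg_quadForm_add_linear {n : ℕ} {A : Matrix (Fin n) (Fin n) ℝ}
    (hA : A.PosDef) {r : ℝ} (hr : 0 < r) (u : Fin n → ℝ) :
    ∫⁻ x : Fin n → ℝ,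
        ENNReal.ofReal (Real.exp (-(2 * ((A *ᵥ u) ⬝ᵥ x) + r⁻¹ * (x ⬝ᵥ (A *ᵥ x))))) =
      ENNReal.ofReal (Real.exp (r * ((A *ᵥ u) ⬝ᵥ u)) *
        ((Real.pi * r) ^ ((n : ℝ) / 2) * A.det ^ (-(1 / 2) : ℝ))) := by
  have hsymm : ∀ x, x ⬝ᵥ (A *ᵥ u) = u ⬝ᵥ (A *ᵥ x) := by
    intro x
    have hT : Aᵀ = A := by
      have := hA.isHermitian
      rwa [IsHermitian, conjTranspose_eq_transpose_of_trivial] at this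
    rw [dotProduct_mulVec, ← mulVec_transpose, hT, dotProduct_comm]
  rw [← lintegral_sub_right_eq_self _ (r • u)]
  have h : ∀ x : Fin n → ℝ, Real.exp (-(2 * ((A *ᵥ u) ⬝ᵥ (x - r • u)) +
      r⁻¹ * ((x - r • u) ⬝ᵥ (A *ᵥ (x - r • u))))) =
      Real.exp (r * ((A *ᵥ u) ⬝ᵥ u)) * Real.exp (-r⁻¹ * (x ⬝ᵥ (A *ᵥ x))) := by
    intro x
    rw [← Real.exp_add]
    congr 1
    simp only [mulVec_sub, mulVec_smul, dotProduct_sub, sub_dotProduct, dotProduct_smul,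
      smul_dotProduct, smul_eq_mul]
    rw [dotProduct_comm (A *ᵥ u) x, dotProduct_comm (A *ᵥ u) u, hsymm x]
    field_simp
    ring
  simp_rw [h, ENNReal.ofReal_mul (Real.exp_pos _).le]
  rw [lintegral_const_mul' _ _ ENNReal.ofReal_ne_top, lintegral_exp_neg_quadForm hA (inv_pos.2 hr),
    div_inv_eq_mul]

theorem lintegral_rpow_mul_exp_neg_mul_Ioi {a r : ℝ} (ha : 0 < a) (hr : 0 < r) :
    ∫⁻ t in Set.Ioi (0 : ℝ), ENNReal.ofReal (t ^ (a - 1) * Real.exp (-(r * t))) =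
      ENNReal.ofReal (r ^ (-a) * Real.Gamma a) := by
  have hval := Real.integral_rpow_mul_exp_neg_mul_Ioi ha hr
  -- A nonintegrable function has integral `0` by convention, whereas the known value is positive.
  have hint : IntegrableOn (fun t : ℝ => t ^ (a - 1) * Real.exp (-(r * t))) (Set.Ioi 0) := by
    by_contra h
    rw [integral_undef h] at hval
    have := Real.Gamma_pos_of_pos ha
    have : 0 < (1 / r) ^ a := by positivity
    have : 0 < (1 / r) ^ a * Real.Gamma a := by positivity
    linarith
  rw [← ofReal_integral_eq_lintegral_ofReal hint, hval, one_div, Real.inv_rpow hr.le,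
    Real.rpow_neg hr.le]
  filter_upwards [self_mem_ae_restrict measurableSet_Ioi] with t ht
  exact mul_nonneg (Real.rpow_nonneg (le_of_lt ht) _) (Real.exp_pos _).le

theorem multivariateGamma_eq_prod_range (m : ℕ) (α : ℝ) :
    multivariateGamma m α = Real.pi ^ ((m : ℝ) * ((m : ℝ) - 1) / 4) *
      ∏ j ∈ Finset.range m, Real.Gamma (α - (j : ℝ) / 2) := by
  rw [multivariateGamma, Finset.range_eq_Ico, Finset.prod_Ico_eq_prod_range]
  congr 1
  rw [← Finset.Ico_add_one_right_eq_Icc, Finset.prod_Ico_eq_prod_range]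
  refine Finset.prod_congr (by simp) fun j _ => ?_
  congr 2
  push_cast
  ring

/-- This recursion mirrors the induction in Siegel's integral: `π^(n/2)` comes from the border,
`Γ(α)` from the corner, and the rest from the Schur complement. -/
theorem multivariateGamma_succ (n : ℕ) (α : ℝ) :
    multivariateGamma (n + 1) α =
      Real.pi ^ ((n : ℝ) / 2) * Real.Gamma α * multivariateGamma n (α - 1 / 2) := by
  rw [multivariateGamma_eq_prod_range, multivariateGamma_eq_prod_range, Finset.prod_range_succ']
  have h1 : Real.pi ^ (((n + 1 : ℕ) : ℝ) * (((n + 1 : ℕ) : ℝ) - 1) / 4) =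
      Real.pi ^ ((n : ℝ) / 2) * Real.pi ^ ((n : ℝ) * ((n : ℝ) - 1) / 4) := by
    rw [← Real.rpow_add Real.pi_pos]
    congr 1
    push_cast
    ring
  have h2 : ∀ j : ℕ, α - ((j + 1 : ℕ) : ℝ) / 2 = α - 1 / 2 - (j : ℝ) / 2 := by
    intro j
    push_cast
    ring
  rw [h1]
  simp_rw [h2]
  simp only [Nat.cast_zero, zero_div, sub_zero]
  ring

theorem multivariateGamma_pos {m : ℕ} {α : ℝ} (hα : ((m : ℝ) - 1) / 2 < α) :
    0 < multivariateGamma m α := by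
  rw [multivariateGamma_eq_prod_range]
  refine mul_pos (Real.rpow_pos_of_pos Real.pi_pos _) (Finset.prod_pos fun j hj => ?_)
  have : ((j + 1 : ℕ) : ℝ) ≤ m := by exact_mod_cast Finset.mem_range.1 hj
  push_cast at this
  exact Real.Gamma_pos_of_pos (by linarith)

/-- The integrand of Siegel's integral. -/
noncomputable def siegelIntegrand (m : ℕ) (α : ℝ) (θ : Sym2 (Fin m) → ℝ) :
    (Sym2 (Fin m) → ℝ) → ℝ :=
  (pdCone m).indicator fun σ =>
    Real.exp (-(traceForm m θ σ)) * (symMat σ).det ^ (α - ((m : ℝ) + 1) / 2)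

theorem measurable_siegelIntegrand (m : ℕ) (α : ℝ) (θ : Sym2 (Fin m) → ℝ) :
    Measurable (siegelIntegrand m α θ) := by
  refine Measurable.indicator ?_ isOpen_pdCone.measurableSet
  have h1 : Measurable (traceForm m θ) :=
    (traceForm m θ).continuous_of_finiteDimensional.measurable
  have h2 : Measurable fun σ : Sym2 (Fin m) → ℝ => (symMat σ).det :=
    continuous_symMat.matrix_det.measurable
  fun_prop

theorem siegelIntegrand_nonneg (m : ℕ) (α : ℝ) (θ σ : Sym2 (Fin m) → ℝ) :
    0 ≤ siegelIntegrand m α θ σ := by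
  refine Set.indicator_nonneg (fun x hx => ?_) σ
  exact mul_nonneg (Real.exp_pos _).le (Real.rpow_nonneg (PosDef.det_pos hx).le _)

/-- The exponent of `det s` stays `α - (n+2)/2`, which in size `n` reads `(α - 1/2) - (n+1)/2`;
hence the shift of `α` by `1/2`. -/
theorem siegelIntegrand_symCons {n : ℕ} {α : ℝ} {a₀ a : ℝ} (ha : 0 < a) (b₀ b : Fin n → ℝ)
    (s₀ s : Sym2 (Fin n) → ℝ) :
    siegelIntegrand (n + 1) α (symCons a₀ b₀ s₀) (symCons a b (s + a⁻¹ • symOuter b)) =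
      Real.exp (-(a₀ * a)) * a ^ (α - ((n : ℝ) + 2) / 2) *
        Real.exp (-(2 * (b₀ ⬝ᵥ b) + a⁻¹ * (b ⬝ᵥ (symMat s₀ *ᵥ b)))) *
        siegelIntegrand n (α - 1 / 2) s₀ s := by
  by_cases hs : s ∈ pdCone n
  · rw [siegelIntegrand, siegelIntegrand, Set.indicator_of_mem hs,
      Set.indicator_of_mem ((symCons_add_symOuter_mem_pdCone_iff ha b s).2 hs),
      det_symMat_symCons_add_symOuter ha.ne', traceForm_symCons, map_add, map_smul,
      traceForm_symOuter, Real.mul_rpow ha.le (PosDef.det_pos hs).le]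
    have h1 : α - (((n + 1 : ℕ) : ℝ) + 1) / 2 = α - ((n : ℝ) + 2) / 2 := by
      push_cast
      ring
    have h2 : α - 1 / 2 - ((n : ℝ) + 1) / 2 = α - ((n : ℝ) + 2) / 2 := by ring
    have h3 : Real.exp (-(a₀ * a + 2 * (b₀ ⬝ᵥ b) +
        (traceForm n s₀ s + a⁻¹ • (b ⬝ᵥ (symMat s₀ *ᵥ b))))) =
        Real.exp (-(a₀ * a)) * Real.exp (-(2 * (b₀ ⬝ᵥ b) + a⁻¹ * (b ⬝ᵥ (symMat s₀ *ᵥ b)))) *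
          Real.exp (-(traceForm n s₀ s)) := by
      rw [← Real.exp_add, ← Real.exp_add]
      congr 1
      rw [smul_eq_mul]
      ring
    rw [h1, h2, h3]
    ring
  · rw [siegelIntegrand, siegelIntegrand, Set.indicator_of_notMem hs, Set.indicator_of_notMem
      fun h => hs ((symCons_add_symOuter_mem_pdCone_iff ha b s).1 h), mul_zero]

/-- **Siegel's integral**: the Laplace transform of a power of the determinant on the cone of
positive definite matrices. -/
theorem lintegral_siegelIntegrand (m : ℕ) {α : ℝ} (hα : ((m : ℝ) - 1) / 2 < α)
    {θ : Sym2 (Fin m) → ℝ} (hθ : θ ∈ pdCone m) :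
    ∫⁻ σ, ENNReal.ofReal (siegelIntegrand m α θ σ) =
      ENNReal.ofReal (multivariateGamma m α * (symMat θ).det ^ (-α)) := by
  induction m generalizing α with
  | zero =>
    have hmem : ∀ σ : Sym2 (Fin 0) → ℝ, σ ∈ pdCone 0 := fun σ =>
      mem_pdCone_iff.2 fun v hv => absurd (Subsingleton.elim v 0) hv
    have h1 : ∀ σ, siegelIntegrand 0 α θ σ = 1 := by
      intro σ
      rw [siegelIntegrand, Set.indicator_of_mem (hmem σ), traceForm_apply]
      simp
    simp_rw [h1]
    simp [multivariateGamma, volume_pi]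
  | succ n ih =>
    obtain ⟨a₀, b₀, s₀, rfl⟩ := exists_eq_symCons θ
    have hs₀ : s₀ ∈ pdCone n := block_mem_pdCone_of_symCons hθ
    have hA : (symMat s₀).PosDef := hs₀
    have hdet : 0 < (symMat s₀).det := hA.det_pos
    -- With `u = s₀⁻¹ b₀`, the number `γ` below is the Schur complement of the block `s₀` in `θ`, so
    -- `det θ = γ * det s₀`.
    obtain ⟨u, hu⟩ : ∃ u, symMat s₀ *ᵥ u = b₀ :=
      mulVec_surjective_iff_isUnit.2 hA.isUnit b₀
    have hγ := sub_dotProduct_pos_of_symCons_mem_pdCone hu hθ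
    set γ := a₀ - b₀ ⬝ᵥ u with hγdef
    have hα' : ((n : ℝ) - 1) / 2 < α - 1 / 2 := by
      push_cast at hα
      linarith
    have hα0 : 0 < α := by
      push_cast at hα
      have : (0 : ℝ) ≤ n := n.cast_nonneg
      linarith
    have hG := multivariateGamma_pos hα'
    set c : ℝ := multivariateGamma n (α - 1 / 2) * (symMat s₀).det ^ (-(α - 1 / 2)) with hc
    have hc0 : 0 ≤ c := mul_nonneg hG.le (Real.rpow_nonneg hdet.le _)
    have hmeas := (measurable_siegelIntegrand (n + 1) α (symCons a₀ b₀ s₀)).ennreal_ofReal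
    rw [lintegral_symCons _ hmeas]
    have hinner : ∀ a : ℝ, 0 < a → ∀ b : Fin n → ℝ,
        ∫⁻ s, ENNReal.ofReal (siegelIntegrand (n + 1) α (symCons a₀ b₀ s₀) (symCons a b s)) =
          ENNReal.ofReal (c * (Real.exp (-(a₀ * a)) * a ^ (α - ((n : ℝ) + 2) / 2))) *
            ENNReal.ofReal
              (Real.exp (-(2 * (b₀ ⬝ᵥ b) + a⁻¹ * (b ⬝ᵥ (symMat s₀ *ᵥ b))))) := by
      intro a ha b
      -- For fixed `a` and `b`, translation makes the Schur complement the integration variable.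
      rw [← lintegral_add_right_eq_self _ (a⁻¹ • symOuter b)]
      have hnn : 0 ≤ Real.exp (-(a₀ * a)) * a ^ (α - ((n : ℝ) + 2) / 2) := by positivity
      have hnn' : 0 ≤ Real.exp (-(a₀ * a)) * a ^ (α - ((n : ℝ) + 2) / 2) *
        Real.exp (-(2 * (b₀ ⬝ᵥ b) + a⁻¹ * (b ⬝ᵥ (symMat s₀ *ᵥ b)))) := by positivity
      simp_rw [siegelIntegrand_symCons ha, ENNReal.ofReal_mul hnn']
      rw [lintegral_const_mul' _ _ ENNReal.ofReal_ne_top, ih hα' hs₀, ← hc,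
        ENNReal.ofReal_mul hnn, ENNReal.ofReal_mul hc0]
      ring
    have hmid : ∀ a : ℝ,
        ∫⁻ b, ∫⁻ s, ENNReal.ofReal
          (siegelIntegrand (n + 1) α (symCons a₀ b₀ s₀) (symCons a b s)) =
        (Set.Ioi 0).indicator (fun a => ENNReal.ofReal
          (c * (Real.pi ^ ((n : ℝ) / 2) * (symMat s₀).det ^ (-(1 / 2) : ℝ))) *
          ENNReal.ofReal (a ^ (α - 1) * Real.exp (-(γ * a)))) a := by
      intro a
      by_cases ha : 0 < a
      · rw [Set.indicator_of_mem (show a ∈ Set.Ioi 0 from ha)]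
        simp_rw [hinner a ha]
        have hnn : 0 ≤ c * (Real.exp (-(a₀ * a)) * a ^ (α - ((n : ℝ) + 2) / 2)) := by positivity
        rw [lintegral_const_mul' _ _ ENNReal.ofReal_ne_top, ← hu,
          lintegral_exp_neg_quadForm_add_linear hA ha, hu, ← ENNReal.ofReal_mul hnn,
          ← ENNReal.ofReal_mul (by positivity)]
        congr 1
        -- The Gaussian integral contributes `a^(n/2)`, raising the exponent of `a` to `α - 1`, and
        -- `exp(a b₀·u)`, changing the decay rate from `a₀` to `γ`.
        rw [Real.mul_rpow Real.pi_pos.le ha.le,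
          show α - 1 = α - ((n : ℝ) + 2) / 2 + (n : ℝ) / 2 by ring, Real.rpow_add ha,
          show -(γ * a) = -(a₀ * a) + a * (b₀ ⬝ᵥ u) by rw [hγdef]; ring, Real.exp_add]
        ring
      · rw [Set.indicator_of_notMem (show a ∉ Set.Ioi 0 from ha)]
        have : ∀ b s, siegelIntegrand (n + 1) α (symCons a₀ b₀ s₀) (symCons a b s) = 0 := by
          intro b s
          rw [siegelIntegrand, Set.indicator_of_notMem fun h => ha (pos_of_symCons_mem_pdCone h)]
        simp [this]
    simp_rw [hmid]
    rw [lintegral_indicator measurableSet_Ioi, lintegral_const_mul' _ _ ENNReal.ofReal_ne_top,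
      lintegral_rpow_mul_exp_neg_mul_Ioi hα0 hγ, ← ENNReal.ofReal_mul (by positivity)]
    congr 1
    rw [multivariateGamma_succ, det_symMat_symCons_of_mulVec_eq hu, Real.mul_rpow hγ.le hdet.le,
      hc, show -α = -(α - 1 / 2) + -(1 / 2) by ring, Real.rpow_add hdet]
    ring

end SiegelIntegral

/-! ### Fourier inversion for a nondegenerate bilinear form -/

section FourierInversion

open Matrix FourierTransform

variable {ι : Type*} [Fintype ι] [DecidableEq ι]

theorem det_toMatrix_ne_zero_of_injective {B : LinearMap.BilinForm ℝ (ι → ℝ)}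
    (hB : Function.Injective B) : (LinearMap.BilinForm.toMatrix (Pi.basisFun ℝ ι) B).det ≠ 0 := by
  intro h
  obtain ⟨v, hv, hvS⟩ := exists_vecMul_eq_zero_iff.2 h
  refine hv (hB ?_)
  rw [map_zero]
  ext1 i
  ext
  have := B.apply_eq_dotProduct_toMatrix_mulVec (Pi.basisFun ℝ ι) v (Pi.single i 1)
  rw [dotProduct_mulVec] at this
  have hrepr : ((Pi.basisFun ℝ ι).repr v : ι → ℝ) = v := by
    ext j
    simp
  rw [hrepr, hvS, zero_dotProduct] at this
  simpa using this

/-- Fourier inversion on `ℝ^ι` with the characters `σ ↦ exp(i B(η, σ))` of a nondegenerate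
bilinear form. -/
theorem integral_cexp_bilin_fourier_inversion {B : LinearMap.BilinForm ℝ (ι → ℝ)}
    (hB : Function.Injective B) {F : (ι → ℝ) → ℂ} (hF : Integrable F) (hFc : Continuous F)
    (hG : Integrable fun η => ∫ σ, Complex.exp (-(Complex.I * (B η σ : ℂ))) * F σ) (τ : ι → ℝ) :
    (((2 * Real.pi) ^ (-(Fintype.card ι : ℝ)) *
      |(LinearMap.BilinForm.toMatrix (Pi.basisFun ℝ ι) B).det| : ℝ) : ℂ) *
      ∫ η, (∫ σ, Complex.exp (-(Complex.I * (B η σ : ℂ))) * F σ) *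
        Complex.exp (Complex.I * (B η τ : ℂ)) = F τ := by
  set S := LinearMap.BilinForm.toMatrix (Pi.basisFun ℝ ι) B with hS
  have hSdet : S.det ≠ 0 := det_toMatrix_ne_zero_of_injective hB
  -- Chosen so that `B η σ = 2π (Mη)·σ`, the normalisation of `𝓕`.
  set M : Matrix ι ι ℝ := (2 * Real.pi)⁻¹ • Sᵀ with hM
  have hMdet : M.det = (2 * Real.pi) ^ (-(Fintype.card ι : ℝ)) * S.det := by
    rw [hM, det_smul, det_transpose, Real.rpow_neg (by positivity), Real.rpow_natCast, inv_pow]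
  have hMdet0 : M.det ≠ 0 := by
    rw [hMdet]
    positivity
  have hBM : ∀ η σ, B η σ = 2 * Real.pi * ((M *ᵥ η) ⬝ᵥ σ) := by
    intro η σ
    have := B.apply_eq_dotProduct_toMatrix_mulVec (Pi.basisFun ℝ ι) η σ
    have hr : ∀ x : ι → ℝ, ((Pi.basisFun ℝ ι).repr x : ι → ℝ) = x := fun x => by
      ext j
      simp
    rw [this, hr, hr, ← hS, dotProduct_mulVec, hM, smul_mulVec, mulVec_transpose, smul_dotProduct,
      smul_eq_mul]
    field_simp
  -- `ι → ℝ` carries the sup norm, while `𝓕` is used over an inner product space; the identification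
  -- of the two preserves volume.
  let V := EuclideanSpace ℝ ι
  set F' : V → ℂ := fun v => F (WithLp.ofLp v) with hF'
  have hofLp := PiLp.volume_preserving_ofLp ι
  have htoLp := PiLp.volume_preserving_toLp ι
  have hembO : MeasurableEmbedding (WithLp.ofLp : V → ι → ℝ) :=
    (MeasurableEquiv.toLp 2 (ι → ℝ)).symm.measurableEmbedding
  have hembT : MeasurableEmbedding (WithLp.toLp 2 : (ι → ℝ) → V) :=
    (MeasurableEquiv.toLp 2 (ι → ℝ)).measurableEmbedding
  have hembM : MeasurableEmbedding (toLin' M) :=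
    (LinearMap.isClosedEmbedding_of_injective (LinearMap.ker_eq_bot.2
      (mulVec_injective_iff_isUnit.2 ((isUnit_iff_isUnit_det M).2
        (isUnit_iff_ne_zero.2 hMdet0))))).measurableEmbedding
  have hinner : ∀ x y : ι → ℝ, inner ℝ (WithLp.toLp 2 x : V) (WithLp.toLp 2 y) = y ⬝ᵥ x := by
    intro x y
    rw [EuclideanSpace.inner_eq_star_dotProduct]
    simp
  have hF'i : Integrable F' := (hofLp.integrable_comp_emb hembO).2 hF
  have hfour : ∀ η, 𝓕 F' (WithLp.toLp 2 (toLin' M η)) =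
      ∫ σ, Complex.exp (-(Complex.I * (B η σ : ℂ))) * F σ := by
    intro η
    rw [Real.fourier_eq', ← htoLp.integral_comp hembT]
    refine integral_congr_ae (Filter.Eventually.of_forall fun σ => ?_)
    simp only [hinner, hF', smul_eq_mul, hBM, toLin'_apply]
    congr 2
    push_cast
    ring
  have hmap := Real.map_matrix_volume_pi_eq_smul_volume_pi hMdet0
  have hc : ENNReal.ofReal |M.det⁻¹| ≠ 0 := by
    rw [ENNReal.ofReal_ne_zero_iff]
    positivity
  have h'f : Integrable (𝓕 F') := by
    rw [← htoLp.integrable_comp_emb hembT]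
    have h1 : Integrable ((𝓕 F' ∘ WithLp.toLp 2) ∘ toLin' M) := hG.congr
      (Filter.Eventually.of_forall fun η => (hfour η).symm)
    rw [← hembM.integrable_map_iff, hmap] at h1
    exact (integrable_smul_measure hc ENNReal.ofReal_ne_top).1 h1
  have hinv := hF'i.fourierInv_fourier_eq h'f (v := WithLp.toLp 2 τ)
    (hFc.comp (PiLp.continuous_ofLp 2 _)).continuousAt
  have hchange : ∫ η, (∫ σ, Complex.exp (-(Complex.I * (B η σ : ℂ))) * F σ) *
        Complex.exp (Complex.I * (B η τ : ℂ)) =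
      |M.det⁻¹| • ∫ w : ι → ℝ, Complex.exp (((2 * Real.pi * (τ ⬝ᵥ w) : ℝ) : ℂ) * Complex.I) •
        𝓕 F' (WithLp.toLp 2 w) := by
    rw [← ENNReal.toReal_ofReal (abs_nonneg M.det⁻¹), ← integral_smul_measure, ← hmap,
      hembM.integral_map]
    refine integral_congr_ae (Filter.Eventually.of_forall fun η => ?_)
    simp only [hfour, smul_eq_mul]
    rw [mul_comm, hBM η τ, toLin'_apply, dotProduct_comm τ, mul_comm Complex.I]
  have hinv' : ∫ w : ι → ℝ, Complex.exp (((2 * Real.pi * (τ ⬝ᵥ w) : ℝ) : ℂ) * Complex.I) •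
        𝓕 F' (WithLp.toLp 2 w) = F τ := by
    rw [Real.fourierInv_eq', ← htoLp.integral_comp hembT] at hinv
    simp only [hinner] at hinv
    exact hinv
  -- The prefactor is `|det M|`, which cancels the Jacobian of `w = Mη`.
  have habs : (2 * Real.pi) ^ (-(Fintype.card ι : ℝ)) * |S.det| = |M.det| := by
    rw [hMdet, abs_mul, abs_of_pos (a := (2 * Real.pi) ^ (-(Fintype.card ι : ℝ))) (by positivity)]
  rw [hchange, hinv', habs, Complex.real_smul, ← mul_assoc, ← Complex.ofReal_mul, ← abs_mul,
    mul_inv_cancel₀ hMdet0]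
  simp

end FourierInversion

/-! ### The Wishart kernel: Laplace transform, uniqueness and Fourier transform -/

section WishartKernel

open Matrix

variable {m : ℕ} {α : ℝ}

theorem exp_neg_traceForm_mul_wishartKernel (α : ℝ) (θ σ : Sym2 (Fin m) → ℝ) :
    Real.exp (-(traceForm m θ σ)) * wishartKernel m α σ =
      (multivariateGamma m α)⁻¹ * siegelIntegrand m α θ σ := by
  by_cases h : σ ∈ pdCone m
  · rw [wishartKernel, siegelIntegrand, Set.indicator_of_mem h, Set.indicator_of_mem h]
    ring
  · rw [wishartKernel, siegelIntegrand, Set.indicator_of_notMem h, Set.indicator_of_notMem h,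
      mul_zero, mul_zero]

theorem integrable_siegelIntegrand (hα : ((m : ℝ) - 1) / 2 < α) {θ : Sym2 (Fin m) → ℝ}
    (hθ : θ ∈ pdCone m) : Integrable (siegelIntegrand m α θ) := by
  rw [← lintegral_ofReal_ne_top_iff_integrable
    (measurable_siegelIntegrand m α θ).aestronglyMeasurable
    (Filter.Eventually.of_forall (siegelIntegrand_nonneg m α θ)), lintegral_siegelIntegrand m hα hθ]
  exact ENNReal.ofReal_ne_top

theorem integrable_exp_neg_mul_wishartKernel (hα : ((m : ℝ) - 1) / 2 < α)
    {θ : Sym2 (Fin m) → ℝ} (hθ : θ ∈ pdCone m) :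
    Integrable fun σ => Real.exp (-(traceForm m θ σ)) * wishartKernel m α σ := by
  simp_rw [exp_neg_traceForm_mul_wishartKernel]
  exact (integrable_siegelIntegrand hα hθ).const_mul _

theorem integral_exp_neg_mul_wishartKernel (hα : ((m : ℝ) - 1) / 2 < α)
    {θ : Sym2 (Fin m) → ℝ} (hθ : θ ∈ pdCone m) :
    ∫ σ, Real.exp (-(traceForm m θ σ)) * wishartKernel m α σ = (symMat θ).det ^ (-α) := by
  have hG := multivariateGamma_pos hα
  have hdet : 0 < (symMat θ).det := PosDef.det_pos hθ
  simp_rw [exp_neg_traceForm_mul_wishartKernel]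
  rw [integral_const_mul, integral_eq_lintegral_of_nonneg_ae
    (Filter.Eventually.of_forall (siegelIntegrand_nonneg m α θ))
    (measurable_siegelIntegrand m α θ).aestronglyMeasurable, lintegral_siegelIntegrand m hα hθ,
    ENNReal.toReal_ofReal (by positivity)]
  field_simp

theorem isRieszKernel_of_ae_eq_wishartKernel (hα : ((m : ℝ) - 1) / 2 < α)
    {q : (Sym2 (Fin m) → ℝ) → ℝ} (hq : q =ᵐ[volume] wishartKernel m α) :
    IsRieszKernel (symDet m) (traceForm m) (pdCone m) α q := by
  have hsupp : ∀ σ, σ ∉ pairingDualCone (traceForm m) (pdCone m) → wishartKernel m α σ = 0 :=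
    fun σ hσ => Set.indicator_of_notMem (fun h => hσ (pdCone_subset_pairingDualCone h)) _
  refine ⟨?_, fun θ hθ => ?_⟩
  · filter_upwards [hq] with σ hσ h
    rw [hσ, hsupp σ h]
  · have hae : (fun σ => Real.exp (-(traceForm m θ σ)) * q σ) =ᵐ[volume]
        fun σ => Real.exp (-(traceForm m θ σ)) * wishartKernel m α σ := by
      filter_upwards [hq] with σ hσ
      rw [hσ]
    refine ⟨((integrable_exp_neg_mul_wishartKernel hα hθ).congr hae.symm).integrableOn, ?_⟩
    rw [integral_congr_ae (ae_restrict_of_ae hae), setIntegral_eq_integral_of_forall_compl_eq_zero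
      (fun σ hσ => by rw [hsupp σ hσ, mul_zero]), integral_exp_neg_mul_wishartKernel hα hθ,
      eval_symDet]

theorem isRieszKernel_symDet_iff (hα : ((m : ℝ) - 1) / 2 < α) (q : (Sym2 (Fin m) → ℝ) → ℝ) :
    IsRieszKernel (symDet m) (traceForm m) (pdCone m) α q ↔ q =ᵐ[volume] wishartKernel m α := by
  refine ⟨fun h => ?_, isRieszKernel_of_ae_eq_wishartKernel hα⟩
  exact h.ae_eq traceForm_surjective (eventually_add_smul_mem_pdCone one_mem_pdCone)
    (isRieszKernel_of_ae_eq_wishartKernel hα Filter.EventuallyEq.rfl)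

theorem wishartKernel_nonneg (hα : ((m : ℝ) - 1) / 2 < α) (σ : Sym2 (Fin m) → ℝ) :
    0 ≤ wishartKernel m α σ := by
  refine Set.indicator_nonneg (fun x hx => ?_) σ
  have hG := multivariateGamma_pos hα
  exact mul_nonneg (by positivity) (Real.rpow_nonneg (PosDef.det_pos hx).le _)

open ProbabilityTheory in
/-- The Laplace transform of the Wishart kernel at complex arguments. -/
theorem integral_cexp_mul_wishartKernel (hα : ((m : ℝ) - 1) / 2 < α) {θ : Sym2 (Fin m) → ℝ}
    (hθ : θ ∈ pdCone m) (η : Sym2 (Fin m) → ℝ) :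
    ∫ σ, Complex.exp (-(Complex.I * (traceForm m η σ : ℂ))) *
      ((Real.exp (-(traceForm m θ σ)) * wishartKernel m α σ : ℝ) : ℂ) =
      hyperbolicNegPow (symDet m) α θ η := by
  obtain ⟨c, -, hc⟩ := exists_pencil_eigenvalues hθ
  obtain ⟨ev, hev, -⟩ := hc η
  have hdet : 0 < (symMat θ).det := PosDef.det_pos hθ
  have hev' : ∀ᶠ t : ℝ in nhds 0, ∀ j, 0 < 1 + t * ev j := by
    refine Filter.eventually_all.2 fun j => ?_
    have : Continuous fun t : ℝ => 1 + t * ev j := by fun_prop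
    exact this.continuousAt.eventually (lt_mem_nhds (by simp))
  obtain ⟨δ, hδ, h⟩ := Metric.eventually_nhds_iff.1
    ((eventually_add_smul_mem_pdCone hθ η).and hev')
  have hmem : ∀ t : ℝ, |t| < δ → θ + t • η ∈ pdCone m := fun t ht => (h (by simpa using ht)).1
  have hpos : ∀ t : ℝ, |t| < δ → ∀ j, 0 < 1 + t * ev j := fun t ht => (h (by simpa using ht)).2
  set H : (Sym2 (Fin m) → ℝ) → ℝ :=
    fun σ => Real.exp (-(traceForm m θ σ)) * wishartKernel m α σ with hH
  have hH0 : ∀ σ, 0 ≤ H σ := fun σ => mul_nonneg (Real.exp_pos _).le (wishartKernel_nonneg hα σ)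
  have hHm : AEMeasurable (fun σ => (H σ).toNNReal) :=
    (integrable_exp_neg_mul_wishartKernel hα hθ).aemeasurable.real_toNNReal
  -- The moment generating function of `X = -⟨η, ·⟩` under `μ` is `t ↦ det(θ + tη)^(-α)` near `0`;
  -- the integral sought is its continuation to `t = i`.
  set μ : Measure (Sym2 (Fin m) → ℝ) :=
    volume.withDensity fun σ => ((H σ).toNNReal : ENNReal) with hμ
  set X : (Sym2 (Fin m) → ℝ) → ℝ := fun σ => -(traceForm m η σ) with hX
  have hfun : ∀ t : ℝ, (fun σ => (H σ).toNNReal • Real.exp (t * X σ)) =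
      fun σ => Real.exp (-(traceForm m (θ + t • η) σ)) * wishartKernel m α σ := by
    intro t
    ext σ
    rw [NNReal.smul_def, Real.coe_toNNReal _ (hH0 σ), smul_eq_mul, hH, hX, map_add, map_smul,
      LinearMap.add_apply, LinearMap.smul_apply, smul_eq_mul, mul_right_comm, ← Real.exp_add]
    congr 2
    ring
  -- On the strip each factor `1 + z * ev j` has positive real part, so its principal power is
  -- holomorphic.
  set Φ : ℂ → ℂ := fun z => (((symMat θ).det ^ (-α) : ℝ) : ℂ) *
    ∏ j, (1 + z * ev j) ^ ((-α : ℝ) : ℂ) with hΦ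
  have hstrip : Set.EqOn (complexMGF X μ) Φ {z | |z.re| < δ} := by
    refine complexMGF_eqOn_strip hδ ?_ (fun t ht => ?_) fun t ht => ?_
    · refine (DifferentiableOn.fun_finsetProd fun j _ => ?_).const_mul _
      refine DifferentiableOn.cpow_const (by fun_prop) fun z hz => Or.inl ?_
      simpa using hpos z.re hz j
    · rw [hμ, integrable_withDensity_iff_integrable_smul₀ hHm, hfun]
      exact integrable_exp_neg_mul_wishartKernel hα (hmem t ht)
    · rw [mgf, hμ, integral_withDensity_eq_integral_smul₀ hHm, hfun,
        integral_exp_neg_mul_wishartKernel hα (hmem t ht)]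
      have := hev 1 t
      rw [one_smul] at this
      rw [this, Real.mul_rpow hdet.le (Finset.prod_nonneg fun j _ => (hpos t ht j).le),
        ← Real.finsetProd_rpow _ _ fun j _ => (hpos t ht j).le, hΦ]
      push_cast
      congr 1
      refine Finset.prod_congr rfl fun j _ => ?_
      have := Complex.ofReal_cpow (hpos t ht j).le (-α)
      push_cast at this
      exact this
  have hI := hstrip (show Complex.I ∈ {z : ℂ | |z.re| < δ} by simpa using hδ)
  rw [hyperbolicNegPow_symDet hθ hev]
  refine Eq.trans ?_ hI
  rw [complexMGF, hμ,
    integral_withDensity_eq_integral_smul₀ hHm]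
  refine integral_congr_ae (Filter.Eventually.of_forall fun σ => ?_)
  simp only [NNReal.smul_def, Real.coe_toNNReal _ (hH0 σ), Complex.real_smul, hX]
  rw [mul_comm, Complex.ofReal_neg, mul_neg]

theorem card_sym2_fin (m : ℕ) :
    (Fintype.card (Sym2 (Fin m)) : ℝ) = (m : ℝ) * ((m : ℝ) + 1) / 2 := by
  rw [← Nat.card_eq_fintype_card, Sym2.natCard, Nat.card_fin, Nat.cast_choose_two]
  push_cast
  ring

/-- The definition through a multiset of roots hides measurability in `η`; it is read off from the
integral representation. -/
theorem aestronglyMeasurable_hyperbolicNegPow_symDet (hα : ((m : ℝ) - 1) / 2 < α)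
    (hcont : Continuous (wishartKernel m α)) {θ : Sym2 (Fin m) → ℝ} (hθ : θ ∈ pdCone m) :
    AEStronglyMeasurable (hyperbolicNegPow (symDet m) α θ) := by
  have hfun : hyperbolicNegPow (symDet m) α θ = fun η =>
      ∫ σ, Complex.exp (-(Complex.I * (traceForm m η σ : ℂ))) *
        ((Real.exp (-(traceForm m θ σ)) * wishartKernel m α σ : ℝ) : ℂ) :=
    funext fun η => (integral_cexp_mul_wishartKernel hα hθ η).symm
  have h1 : Continuous fun p : (Sym2 (Fin m) → ℝ) × (Sym2 (Fin m) → ℝ) =>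
      traceForm m p.1 p.2 := by
    simp only [traceForm_apply]
    exact ((continuous_symMat.comp continuous_fst).matrix_mul
      (continuous_symMat.comp continuous_snd)).matrix_trace
  have h2 : Continuous (traceForm m θ) := (traceForm m θ).continuous_of_finiteDimensional
  rw [hfun]
  refine AEStronglyMeasurable.integral_prod_right'
    (f := fun p : (Sym2 (Fin m) → ℝ) × (Sym2 (Fin m) → ℝ) =>
      Complex.exp (-(Complex.I * (traceForm m p.1 p.2 : ℂ))) *
        ((Real.exp (-(traceForm m θ p.2)) * wishartKernel m α p.2 : ℝ) : ℂ))
    (Continuous.aestronglyMeasurable ?_)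
  fun_prop

theorem integrable_hyperbolicNegPow_symDet (hα : ((m : ℝ) - 1) / 2 < α)
    (hcont : Continuous (wishartKernel m α)) (hαd : (m : ℝ) * ((m : ℝ) + 1) / 2 < α)
    {θ : Sym2 (Fin m) → ℝ} (hθ : θ ∈ pdCone m) :
    Integrable (hyperbolicNegPow (symDet m) α θ) := by
  have hα0 : 0 ≤ α := le_trans (by positivity) hαd.le
  obtain ⟨c, hc, hbound⟩ := norm_hyperbolicNegPow_symDet_le hθ hα0
  have hint : Integrable fun η : Sym2 (Fin m) → ℝ => ((1 : ℝ) + ‖η‖ ^ 2) ^ (-α / 2) :=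
    integrable_rpow_neg_one_add_norm_sq (by
      rwa [Module.finrank_fintype_fun_eq_card, card_sym2_fin])
  exact ((hint.comp_smul hc.ne').const_mul _).mono'
    (aestronglyMeasurable_hyperbolicNegPow_symDet hα hcont hθ)
    (Filter.Eventually.of_forall hbound)

theorem continuous_wishartKernel_of_card_lt (hαd : (m : ℝ) * ((m : ℝ) + 1) / 2 < α) :
    Continuous (wishartKernel m α) := by
  -- The bound `(m+1)/2 ≤ m(m+1)/2` needs `m ≥ 1`; for `m = 0` the space is a point.
  rcases Nat.eq_zero_or_pos m with rfl | hm
  · exact continuous_of_const fun x y => by rw [Subsingleton.elim x y]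
  · refine continuous_wishartKernel (lt_of_le_of_lt ?_ hαd)
    have : (1 : ℝ) ≤ m := by exact_mod_cast hm
    nlinarith

end WishartKernel

/-! ### The proposition -/

theorem mainTheorem7 (m : ℕ) (α : ℝ) (hα : ((m : ℝ) - 1) / 2 < α) :
    (∀ q : (Sym2 (Fin m) → ℝ) → ℝ,
      IsRieszKernel (symDet m) (traceForm m) (pdCone m) α q ↔
        q =ᵐ[volume] wishartKernel m α) ∧
    ((m : ℝ) * ((m : ℝ) + 1) / 2 < α →
      ∀ θ ∈ pdCone m, ∀ σ : Sym2 (Fin m) → ℝ,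
        Integrable (gardingIntegrand (symDet m) (traceForm m) α θ σ) ∧
        gardingIntegral (symDet m) (traceForm m) α θ σ = ((wishartKernel m α σ : ℝ) : ℂ)) := by
  refine ⟨isRieszKernel_symDet_iff hα, fun hαd θ hθ σ => ?_⟩
  have hcont := continuous_wishartKernel_of_card_lt hαd
  have hint := integrable_hyperbolicNegPow_symDet hα hcont hαd hθ
  have hsplit : gardingIntegrand (symDet m) (traceForm m) α θ σ = fun η =>
      Complex.exp (traceForm m θ σ : ℂ) * (hyperbolicNegPow (symDet m) α θ η *
        Complex.exp (Complex.I * (traceForm m η σ : ℂ))) := by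
    ext η
    rw [gardingIntegrand, Complex.exp_add]
    ring
  have hpair : Continuous fun η => traceForm m η σ :=
    ((traceForm m).flip σ).continuous_of_finiteDimensional
  have hint' : Integrable fun η => hyperbolicNegPow (symDet m) α θ η *
      Complex.exp (Complex.I * (traceForm m η σ : ℂ)) := by
    refine hint.mul_bdd (c := 1) (Continuous.aestronglyMeasurable (by fun_prop))
      (Filter.Eventually.of_forall fun η => ?_)
    rw [mul_comm, Complex.norm_exp_ofReal_mul_I]
  refine ⟨hsplit ▸ hint'.const_mul _, ?_⟩
  have hθc : Continuous (traceForm m θ) := (traceForm m θ).continuous_of_finiteDimensional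
  have hinv := integral_cexp_bilin_fourier_inversion (traceForm_injective (m := m))
    (F := fun σ => ((Real.exp (-(traceForm m θ σ)) * wishartKernel m α σ : ℝ) : ℂ))
    (integrable_exp_neg_mul_wishartKernel hα hθ).ofReal (by fun_prop)
    (by simpa only [integral_cexp_mul_wishartKernel hα hθ] using hint) σ
  simp only [integral_cexp_mul_wishartKernel hα hθ] at hinv
  -- Inversion recovers the damped kernel; the factor `exp(⟨θ, σ⟩)` of the integrand removes the
  -- damping.
  rw [gardingIntegral, hsplit, integral_const_mul, mul_left_comm, hinv, Complex.ofReal_mul,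
    ← mul_assoc, Complex.ofReal_exp, ← Complex.exp_add]
  simp
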